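/- Let $K$ be a non-archimedean local field of characteristic $p>0$ with ring of integers $\mathcal O=\{|x|\le 1\}$, prime ideal $\{|x|<1\}$, prime element $\mathfrak p$ (an element of maximal absolute value in the prime ideal), and residue field of $q=p^c$ elements, and let $dx$ be the Haar measure of $K^+$ with $|\mathcal O|=1$. Fix units $1=\epsilon_0,\epsilon_1,\dots,\epsilon_{c-1}\in\mathcal O^*$ whose residue classes form a basis of the residue field over $\mathbb F_p$. For $0\le n<q$, $n=\sum_{k<c}a_kp^k$ with $0\le a_k<p$, put $u(n)=\big(\sum_k a_k\epsilon_k\big)\mathfrak p^{-1}$; for $n=\sum_k b_kq^k$ with $0\le b_k<q$, put $u(n)=\sum_k u(b_k)\mathfrak p^{-k}$. Fix a continuous character $\chi$ of $K^+$ which is trivial on $\mathcal O$, nontrivial on $\mathfrak p^{-1}\mathcal O$, and normalized so that $\chi(u(k)u(l))=1$ for all $k,l\in\mathbb N_0$. Let $\hat f(\xi)=\int_K f(x)\chi(-\xi x)\,dx$, extended from $L^1(K)\cap L^2(K)$ to $L^2(K)$. On $L^2(K)$ let $T_kf(x)=f(x-u(k))$ ($k\in\mathbb N_0$) and $D^jf(x)=q^{j/2}f(\mathfrak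 p^{-j}x)$ ($j\in\mathbb Z$). A family $(e_i)$ in a closed subspace $V\subset L^2(K)$ is a Parseval frame for $V$ if $\sum_i|\langle f,e_i\rangle|^2=\|f\|^2$ for all $f\in V$. A sequence of closed subspaces $(D^jV)_{j\in\mathbb Z}$ of $L^2(K)$ is a Parseval multiresolution analysis (PMRA) with core space $V$ and Parseval scaling function $\varphi\in V$ if $T_kV=V$ for all $k$, $V\subset DV$, $\bigcap_jD^jV=\{0\}$, $\overline{\bigcup_jD^jV}=L^2(K)$, and $(T_k\varphi)_{k\in\mathbb N_0}$ is a Parseval frame for $V$. A family $\Psi=(\psi_1,\dots,\psi_L)$ in $L^2(K)$ is a Parseval multiwavelet of order $L$ if $(D^jT_k\psi_m)_{1\le m\le L,\,j\in\mathbb Z,\,k\in\mathbb N_0}$ is a Parseval frame for $L^2(K)$. A set $W$ is a Parseval multiwavelet set of order $L$ associated with the PMRA with core space $V$ if $W=\bigcup_{m=1}^LW_m$ for measurable sets $W_m$ such that some Parseval multiwavelet $(\psi_1,\dots,\psi_L)$ satisfies $|\hat\psi_m|=\chi_{W_m}$ a.e. for every $m$ and $V=\overline{\mathrm{span}}\{D^jT_k\psi_m: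 j<0,\ k\in\mathbb N_0,\ 1\le m\le L\}$. Here $\chi_E$ is the characteristic function of a set $E$; all equalities and inclusions between subsets of $K$ below are up to null sets. **Proposition 4.4.** Let $S\subset K$ be measurable and let $\varphi\in L^2(K)$ satisfy $|\hat\varphi|=\chi_S$ a.e. Then $\varphi$ is a Parseval scaling function of a PMRA if and only if (i) $\{S+u(k):k\in\mathbb N_0\}$ is a measurable partition of a subset of $K$, that is, $|(S+u(k))\cap(S+u(l))|=0$ for $k\ne l$; (ii) $\bigcup_{j\in\mathbb Z}\mathfrak p^{-j}S=K$; and (iii) $S\subset\mathfrak p^{-1}S$. Moreover, in this case, for every PMRA of which $\varphi$ is a Parseval scaling function, $\mathfrak p^{-1}S\setminus S$ is a Parseval multiwavelet set, of some finite order $L$, associated with this PMRA; and every Parseval multiwavelet set $W$ (of any finite order) associated with this PMRA satisfies $W=\mathfrak p^{-1}S\setminus S$ and $S=\bigcup_{j\ge1}\mathfrak p^{j}W$. -/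

import Mathlib

open MeasureTheory Filter Topology
open scoped Pointwise ENNReal

namespace LocalFieldWavelet

noncomputable section

section Arithmetic

/-- `ϖ` is a prime element: an element of maximal absolute value in the prime ideal
`{x | ‖x‖ < 1}` of the ring of integers `{x | ‖x‖ ≤ 1}`. -/
def IsPrimeElement {K : Type*} [NormedField K] (ϖ : K) : Prop :=
  ‖ϖ‖ < 1 ∧ ∀ x : K, ‖x‖ < 1 → ‖x‖ ≤ ‖ϖ‖

/-- `ε 0 = 1, ε 1, …, ε (c - 1)` are units of the ring of integers whose residue classes form a
basis of the residue field over its prime field with `p` elements: every integer of `K` is, modulo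
the prime ideal, `∑ aᵢ εᵢ` for exactly one choice of coefficients `0 ≤ aᵢ < p`.
In particular the residue field has `p ^ c` elements. -/
structure IsResidueBasis {K : Type*} [NormedField K] (p : ℕ) {c : ℕ} (ε : Fin c → K) : Prop where
  zero_eq_one : ∀ i : Fin c, (i : ℕ) = 0 → ε i = 1
  norm_eq_one : ∀ i, ‖ε i‖ = 1
  existsUnique : ∀ x : K, ‖x‖ ≤ 1 → ∃! a : Fin c → Fin p, ‖x - ∑ i, ((a i : ℕ) : K) * ε i‖ < 1

/-- `u(n) = (∑ a_k ε_k) ϖ⁻¹` for `0 ≤ n < p ^ c` with base `p` expansion `n = ∑ a_k p ^ k`. -/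
def uDigit {K : Type*} [Field K] (p : ℕ) {c : ℕ} (ϖ : Kˣ) (ε : Fin c → K) (n : ℕ) : K :=
  (∑ k : Fin c, ((n / p ^ (k : ℕ) % p : ℕ) : K) * ε k) * (ϖ : K)⁻¹

/-- `u(n) = ∑ u(b_k) ϖ ^ (-k)` where `n = ∑ b_k q ^ k` is the base `q = p ^ c` expansion.
(The digits `b_k` with `k > n` vanish.) -/
def u {K : Type*} [Field K] (p : ℕ) {c : ℕ} (ϖ : Kˣ) (ε : Fin c → K) (n : ℕ) : K :=
  ∑ k ∈ Finset.range (n + 1),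
    uDigit p ϖ ε (n / (p ^ c) ^ k % p ^ c) * ((ϖ : K)⁻¹) ^ k

/-- The normalization of the fixed additive character `χ` of `K`: it is continuous, trivial on the
ring of integers `𝒪`, nontrivial on `ϖ⁻¹ 𝒪`, and it makes the translation set `{u(n)}` self-dual,
that is, `χ (u(k) u(l)) = 1`. -/
structure IsNormalizedCharacter {K : Type*} [NormedField K] (p : ℕ) {c : ℕ} (ϖ : Kˣ)
    (ε : Fin c → K) (χ : AddChar K Circle) : Prop where
  continuous : Continuous χ
  trivial_on_integers : ∀ x : K, ‖x‖ ≤ 1 → χ x = 1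
  nontrivial : ∃ x : K, ‖(ϖ : K) * x‖ ≤ 1 ∧ χ x ≠ 1
  self_dual : ∀ k l : ℕ, χ (u p ϖ ε k * u p ϖ ε l) = 1

end Arithmetic

section ParsevalFrame

/-- The family `e` is a Parseval frame for the subspace `V`. -/
def IsParsevalFrameFor {H : Type*} [NormedAddCommGroup H] [InnerProductSpace ℂ H] {ι : Type*}
    (e : ι → H) (V : Submodule ℂ H) : Prop :=
  (∀ i, e i ∈ V) ∧ ∀ f ∈ V, HasSum (fun i => ‖inner ℂ (e i) f‖ ^ 2) (‖f‖ ^ 2)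

end ParsevalFrame

section Analysis

variable {K : Type*} [NontriviallyNormedField K] [LocallyCompactSpace K]
  [MeasurableSpace K] [BorelSpace K]

/-- `g` is the Fourier transform of `f ∈ L²(K)`: the `L²`-limit of the Fourier integrals
`ξ ↦ ∫ f(x) χ(-xξ) dx` of the truncations of `f` to the balls `{x | ‖x‖ ≤ n}`. -/
def IsFourierTransform (χ : AddChar K Circle) (μ : Measure K) (f g : K → ℂ) : Prop :=
  MemLp g 2 μ ∧
    Tendsto (fun n : ℕ => eLpNorm (fun ξ =>
      Fourier.fourierIntegral χ μ ((Metric.closedBall (0 : K) n).indicator f) ξ - g ξ) 2 μ)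
      atTop (𝓝 0)

/-- `|f̂| = 1_S` almost everywhere, where `f̂` is the Fourier transform of `f ∈ L²(K)`. -/
def FourierModulusEq (χ : AddChar K Circle) (μ : Measure K) (f : Lp ℂ 2 μ) (S : Set K) : Prop :=
  ∃ g : K → ℂ, IsFourierTransform χ μ f g ∧ (fun ξ => ‖g ξ‖) =ᵐ[μ] S.indicator (fun _ => (1 : ℝ))

variable (μ : Measure K) [μ.IsAddHaarMeasure]

theorem exists_map_smul_eq (a : Kˣ) :
    ∃ r : ℝ≥0∞, r ≠ ∞ ∧ Measure.map (fun x : K => a • x) μ = r • μ := by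
  have : ProperSpace K := ProperSpace.of_locallyCompactSpace K
  refine ⟨distribHaarChar K a⁻¹, ENNReal.coe_ne_top, ?_⟩
  ext s hs
  rw [Measure.map_apply (measurable_const_smul a) hs, Set.preimage_smul, Measure.smul_apply,
    ← distribHaarChar_mul μ a⁻¹ s]
  rfl

theorem quasiMeasurePreserving_smul (a : Kˣ) :
    Measure.QuasiMeasurePreserving (fun x : K => a • x) μ μ := by
  obtain ⟨r, -, h⟩ := exists_map_smul_eq μ a
  refine ⟨measurable_const_smul a, ?_⟩
  rw [h]
  exact Measure.smul_absolutelyContinuous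

theorem memLp_comp_smul (a : Kˣ) {f : K → ℂ} (hf : MemLp f 2 μ) :
    MemLp (fun x => f (a • x)) 2 μ := by
  obtain ⟨r, hr, h⟩ := exists_map_smul_eq μ a
  have h1 : MemLp f 2 (Measure.map (fun x : K => a • x) μ) := by
    rw [h]; exact hf.smul_measure hr
  exact h1.comp_of_map (measurable_const_smul a).aemeasurable

/-- Translation on `L²(K)`: `f ↦ f(· - y)`. -/
def translation (y : K) : Lp ℂ 2 μ →ₗ[ℂ] Lp ℂ 2 μ :=
  Lp.compMeasurePreservingₗ ℂ (fun x => x - y) (measurePreserving_sub_right μ y)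

/-- Dilation on `L²(K)`: `D^j f (x) = q^{j/2} f(ϖ^{-j} x)`. -/
def dilation (q : ℕ) (ϖ : Kˣ) (j : ℤ) : Lp ℂ 2 μ →ₗ[ℂ] Lp ℂ 2 μ where
  toFun f := (((q : ℝ) ^ ((j : ℝ) / 2) : ℝ) : ℂ) •
    (memLp_comp_smul μ (ϖ ^ (-j)) (Lp.memLp f)).toLp (fun x => f (ϖ ^ (-j) • x))
  map_add' f g := by
    rw [← smul_add, ← MemLp.toLp_add]
    refine congrArg (fun h : Lp ℂ 2 μ => (((q : ℝ) ^ ((j : ℝ) / 2) : ℝ) : ℂ) • h)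
      (MemLp.toLp_congr _ _ ?_)
    exact (quasiMeasurePreserving_smul μ (ϖ ^ (-j))).ae_eq_comp (Lp.coeFn_add f g)
  map_smul' z f := by
    rw [RingHom.id_apply, smul_comm z]
    refine congrArg (fun h : Lp ℂ 2 μ => (((q : ℝ) ^ ((j : ℝ) / 2) : ℝ) : ℂ) • h) (Lp.ext ?_)
    filter_upwards [MemLp.coeFn_toLp (memLp_comp_smul μ (ϖ ^ (-j)) (Lp.memLp (z • f))),
      Lp.coeFn_smul z ((memLp_comp_smul μ (ϖ ^ (-j)) (Lp.memLp f)).toLp _),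
      MemLp.coeFn_toLp (memLp_comp_smul μ (ϖ ^ (-j)) (Lp.memLp f)),
      (quasiMeasurePreserving_smul μ (ϖ ^ (-j))).ae_eq_comp (Lp.coeFn_smul z f)] with x h1 h2 h3 h4
    rw [h1, h2, Pi.smul_apply, h3]
    exact h4

variable (p : ℕ) {c : ℕ} (ϖ : Kˣ) (ε : Fin c → K)

/-- The translation operators `T_k f = f(· - u(k))`. -/
def T (k : ℕ) : Lp ℂ 2 μ →ₗ[ℂ] Lp ℂ 2 μ := translation μ (u p ϖ ε k)

/-- The sequence `(D^j V)_{j ∈ ℤ}` of closed subspaces of `L²(K)` is a Parseval multiresolution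
analysis with Parseval scaling function `φ`; here `q = p ^ c`. -/
structure IsPMRA (V : Submodule ℂ (Lp ℂ 2 μ)) (φ : Lp ℂ 2 μ) : Prop where
  isClosed : ∀ j : ℤ, IsClosed (V.map (dilation μ (p ^ c) ϖ j) : Set (Lp ℂ 2 μ))
  translation_invariant : ∀ k : ℕ, V.map (T μ p ϖ ε k) = V
  le_dilation : V ≤ V.map (dilation μ (p ^ c) ϖ 1)
  iInf_eq_bot : ⨅ j : ℤ, V.map (dilation μ (p ^ c) ϖ j) = ⊥
  closure_iUnion : closure (⋃ j : ℤ, (V.map (dilation μ (p ^ c) ϖ j) : Set (Lp ℂ 2 μ))) = Set.univ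
  mem : φ ∈ V
  parseval : IsParsevalFrameFor (fun k : ℕ => T μ p ϖ ε k φ) V

/-- The affine system `D^j T_k ψ_m`, `1 ≤ m ≤ L`, `j ∈ ℤ`, `k ∈ ℕ₀`. -/
def affineSystem {L : ℕ} (ψ : Fin L → Lp ℂ 2 μ) (i : Fin L × ℤ × ℕ) : Lp ℂ 2 μ :=
  dilation μ (p ^ c) ϖ i.2.1 (T μ p ϖ ε i.2.2 (ψ i.1))

/-- `ψ` is a Parseval multiwavelet of order `L`: its affine system is a Parseval frame for
`L²(K)`. -/
def IsParsevalMultiwavelet {L : ℕ} (ψ : Fin L → Lp ℂ 2 μ) : Prop :=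
  IsParsevalFrameFor (affineSystem μ p ϖ ε ψ) ⊤

/-- The space of negative dilates of `ψ`: the closed span of the `D^j T_k ψ_m` with `j < 0`. -/
def negativeDilates {L : ℕ} (ψ : Fin L → Lp ℂ 2 μ) : Submodule ℂ (Lp ℂ 2 μ) :=
  (Submodule.span ℂ (affineSystem μ p ϖ ε ψ '' {i | i.2.1 < 0})).topologicalClosure

/-- `W` is a Parseval multiwavelet set of order `L` associated with the multiresolution analysis
`(D^j V)_{j ∈ ℤ}`: `W` is a union of measurable sets `W_1, …, W_L` for which there is a Parseval
multiwavelet `ψ_1, …, ψ_L` with `|ψ̂_m| = 1_{W_m}` whose space of negative dilates is `V`. -/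
def IsParsevalMultiwaveletSetOf (χ : AddChar K Circle) (V : Submodule ℂ (Lp ℂ 2 μ)) (L : ℕ)
    (W : Set K) : Prop :=
  ∃ (ψ : Fin L → Lp ℂ 2 μ) (Wm : Fin L → Set K),
    (∀ m, MeasurableSet (Wm m)) ∧ W = ⋃ m, Wm m ∧
    (∀ m, FourierModulusEq χ μ (ψ m) (Wm m)) ∧
    IsParsevalMultiwavelet μ p ϖ ε ψ ∧
    negativeDilates μ p ϖ ε ψ = V

end Analysis

end

end LocalFieldWavelet

set_option linter.unusedSectionVars false

namespace LocalFieldWavelet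

/-! On the Fourier side, translation by `u(k)` becomes multiplication by the character `ξ ↦
χ(-u(k)ξ)` and `D^j` becomes `D^(-j)`. Everything then reduces to the behaviour of the set `S` under
translations by the `u(n)` and multiplication by powers of `ϖ`.

The `u(n)` form a group of representatives of `K/𝒪`, and `χ` is trivial on their products. Hence the
Gabor functions `1_{u(k)+𝒪} χ(u(l)·)` are an orthonormal basis that the Fourier transform permutes.
This yields the unitary `fourierL2`, which agrees with the truncated-integral definition
(`isFourierTransform_iff`).

If `|φ̂| = 1_S`, periodization turns `∑_k |⟨T_k φ, f⟩|²` into the squared norm on `𝒪` of `∑_n F(· +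
u(n))`, where `F` is the product of `f̂` with the conjugate of `φ̂`. Disjoint translates of `S` give
the Parseval identity on functions with spectrum in `S` (`tsum_enorm_inner_modulation`). Conversely,
Bessel's inequality for `φ` alone forces disjointness (`translatesDisjoint_of_tsum_le`): the number
of `n` with `x + u(n) ∈ S` has a square whose integral does not exceed its own. So the core space
can only be the space of functions with spectrum in `S` (`bandlimited_of_isPMRA`), and its dilates
are those with spectrum in `ϖ^(-j)S`. Nesting and density become (iii) and (ii). Triviality of the
intersection is automatic, because `S` has finite measure and dilation multiplies measure by a power
of `q > 1`.

Under (ii) and (iii), almost every orbit `j ↦ ϖ^j x` lies in `S` exactly from some index on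
(`exists_threshold`), so it meets `ϖ⁻¹S \ S` exactly once. For systems with `|ψ̂_m| = 1_{W_m}`, the
Parseval property means that almost every orbit meets exactly one `W_m`, exactly once
(`isParsevalMultiwavelet_iff`). Cutting `ϖ⁻¹S \ S` into `q` pieces with disjoint translates gives
existence. Uniqueness is read off from the index at which an orbit meets `W`. -/

/-- The standing assumptions on the arithmetic data: `K` has characteristic `p`, `ϖ` is a prime
element and `ε` represents a basis of the residue field. -/
structure IsDigitSystem {K : Type*} [NormedField K] (p : ℕ) {c : ℕ} (ϖ : Kˣ) (ε : Fin c → K) :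
    Prop where
  prime : p.Prime
  charP : CharP K p
  isPrimeElement : IsPrimeElement (ϖ : K)
  isResidueBasis : IsResidueBasis p ε

/-- The representative `∑ a_k ε_k` of the residue class with number `n = ∑ a_k p ^ k`. -/
noncomputable def residueRep {K : Type*} [Field K] (p : ℕ) {c : ℕ} (ε : Fin c → K) (n : ℕ) : K :=
  ∑ k : Fin c, ((n / p ^ (k : ℕ) % p : ℕ) : K) * ε k

/-! ### Digit expansions: the `u(n)` as a group of representatives of `K/𝒪`. -/

section Arithmetic

variable {K : Type*} [NormedField K] [IsUltrametricDist K] {p c : ℕ} {ϖ : Kˣ} {ε : Fin c → K}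

theorem uDigit_eq (n : ℕ) : uDigit p ϖ ε n = residueRep p ε n * (ϖ : K)⁻¹ := rfl

theorem residueRep_zero : residueRep p ε 0 = 0 := by simp [residueRep]

namespace IsDigitSystem

variable (h : IsDigitSystem p ϖ ε)
include h

theorem norm_pos : 0 < ‖(ϖ : K)‖ := norm_pos_iff.2 ϖ.ne_zero

theorem norm_lt_one : ‖(ϖ : K)‖ < 1 := h.isPrimeElement.1

theorem one_lt_inv_norm : 1 < ‖(ϖ : K)‖⁻¹ := (one_lt_inv₀ h.norm_pos).2 h.norm_lt_one

theorem c_ne_zero : c ≠ 0 := by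
  rintro rfl
  obtain ⟨a, ha, -⟩ := h.isResidueBasis.existsUnique 1 (by simp)
  simp at ha

theorem one_lt_q : 1 < p ^ c := Nat.one_lt_pow h.c_ne_zero h.prime.one_lt

theorem q_pos : 0 < p ^ c := zero_lt_one.trans h.one_lt_q

theorem norm_residueRep_le (n : ℕ) : ‖residueRep p ε n‖ ≤ 1 := by
  refine IsUltrametricDist.norm_sum_le_of_forall_le_of_nonneg zero_le_one fun i _ => ?_
  rw [norm_mul, h.isResidueBasis.norm_eq_one, mul_one]
  exact IsUltrametricDist.norm_natCast_le_one K _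

theorem exists_residueRep {x : K} (hx : ‖x‖ ≤ 1) : ∃ b < p ^ c, ‖x - residueRep p ε b‖ < 1 := by
  obtain ⟨a, ha, -⟩ := h.isResidueBasis.existsUnique x hx
  refine ⟨finFunctionFinEquiv a, Fin.is_lt _, ?_⟩
  have : ∀ k : Fin c, ((finFunctionFinEquiv a : Fin (p ^ c)) : ℕ) / p ^ (k : ℕ) % p = a k := by
    intro k
    conv_rhs => rw [← finFunctionFinEquiv.symm_apply_apply a]
    rfl
  simpa only [residueRep, this] using ha

theorem residueRep_injOn {x : K} (hx : ‖x‖ ≤ 1) {a b : ℕ} (ha : a < p ^ c) (hb : b < p ^ c)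
    (hxa : ‖x - residueRep p ε a‖ < 1) (hxb : ‖x - residueRep p ε b‖ < 1) : a = b := by
  have := (h.isResidueBasis.existsUnique x hx).unique
    (y₁ := finFunctionFinEquiv.symm ⟨a, ha⟩) (y₂ := finFunctionFinEquiv.symm ⟨b, hb⟩) hxa hxb
  simpa using this

/-- In characteristic `p` the coefficients matter only modulo `p`, so base `p` digits can be
subtracted without carries. This makes the `u(n)` a group. -/
theorem exists_residueRep_sub (a b : ℕ) :
    ∃ e < p ^ c, residueRep p ε a - residueRep p ε b = residueRep p ε e := by
  have := h.charP
  have hp := h.prime.pos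
  let f : Fin c → Fin p := fun k =>
    ⟨(a / p ^ (k : ℕ) % p + (p - b / p ^ (k : ℕ) % p)) % p, Nat.mod_lt _ hp⟩
  refine ⟨finFunctionFinEquiv f, Fin.is_lt _, ?_⟩
  have : ∀ k : Fin c, ((finFunctionFinEquiv f : Fin (p ^ c)) : ℕ) / p ^ (k : ℕ) % p = f k := by
    intro k
    conv_rhs => rw [← finFunctionFinEquiv.symm_apply_apply f]
    rfl
  simp only [residueRep, this, ← Finset.sum_sub_distrib, ← sub_mul]
  refine Finset.sum_congr rfl fun k _ => ?_
  congr 1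
  simp only [f]
  have hmod : ∀ n : ℕ, ((n % p : ℕ) : K) = n := fun n => by
    conv_rhs => rw [← Nat.mod_add_div n p]
    simp
  rw [hmod (_ + _)]
  push_cast [(Nat.mod_lt (b / p ^ (k : ℕ)) hp).le]
  simp [sub_eq_add_neg]

theorem u_eq_sum {n M : ℕ} (hM : n < M) : u p ϖ ε n =
    ∑ k ∈ Finset.range M, uDigit p ϖ ε (n / (p ^ c) ^ k % p ^ c) * ((ϖ : K)⁻¹) ^ k := by
  refine Finset.sum_subset (Finset.range_mono hM) fun k _ hk => ?_
  rw [Finset.mem_range, not_lt] at hk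
  rw [Nat.div_eq_of_lt, Nat.zero_mod, uDigit_eq, residueRep_zero, zero_mul, zero_mul]
  exact lt_of_lt_of_le (Nat.lt_succ_self n) (hk.trans (Nat.lt_pow_self h.one_lt_q).le)

/-- Splitting off the lowest base `q` digit gives the recursion behind the inductions below. -/
theorem u_add_mul {b : ℕ} (hb : b < p ^ c) (n : ℕ) :
    u p ϖ ε (b + p ^ c * n) = (ϖ : K)⁻¹ * (residueRep p ε b + u p ϖ ε n) := by
  -- The upper limits differ by one and exceed both indices, so removing the zeroth term on the left
  -- leaves the same range on the right.
  rw [h.u_eq_sum (show b + p ^ c * n < b + p ^ c * n + n + 1 + 1 by omega),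
    h.u_eq_sum (show n < b + p ^ c * n + n + 1 by omega), Finset.sum_range_succ', mul_add,
    Finset.mul_sum, add_comm]
  congr 1
  · simp [uDigit_eq, Nat.mod_eq_of_lt hb, mul_comm]
  · refine Finset.sum_congr rfl fun k _ => ?_
    have : (b + p ^ c * n) / (p ^ c) ^ (k + 1) = n / (p ^ c) ^ k := by
      rw [pow_succ', ← Nat.div_div_eq_div_mul, Nat.add_mul_div_left _ _ h.q_pos,
        Nat.div_eq_of_lt hb, zero_add]
    rw [this, pow_succ]
    ring

theorem u_zero : u p ϖ ε 0 = 0 := by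
  simp [u, uDigit_eq, residueRep_zero]

theorem exists_eq_add_mul (n : ℕ) : ∃ b < p ^ c, ∃ m, n = b + p ^ c * m :=
  ⟨n % p ^ c, Nat.mod_lt _ h.q_pos, n / p ^ c, (Nat.mod_add_div _ _).symm⟩

/-- There are no carries between base `q` digits either. The bound `q ^ N` is kept because the
character sums below run over this finite group. -/
theorem exists_u_sub_lt (N : ℕ) : ∀ m < (p ^ c) ^ N, ∀ n < (p ^ c) ^ N,
    ∃ l < (p ^ c) ^ N, u p ϖ ε m - u p ϖ ε n = u p ϖ ε l := by
  induction N with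
  | zero => intro m hm n hn; exact ⟨0, by simp, by simp_all [h.u_zero]⟩
  | succ N ih =>
    intro m hm n hn
    obtain ⟨a, ha, m, rfl⟩ := h.exists_eq_add_mul m
    obtain ⟨b, hb, n, rfl⟩ := h.exists_eq_add_mul n
    rw [pow_succ'] at hm hn ⊢
    obtain ⟨l, hl, hmn⟩ := ih m (lt_of_mul_lt_mul_left (by omega) (Nat.zero_le (p ^ c)))
      n (lt_of_mul_lt_mul_left (by omega) (Nat.zero_le (p ^ c)))
    obtain ⟨e, he, hab⟩ := h.exists_residueRep_sub a b
    refine ⟨e + p ^ c * l, ?_, ?_⟩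
    · calc e + p ^ c * l < p ^ c + p ^ c * l := by omega
        _ = p ^ c * (l + 1) := by ring
        _ ≤ _ := Nat.mul_le_mul_left _ hl
    · rw [h.u_add_mul ha, h.u_add_mul hb, h.u_add_mul he, ← hab, ← hmn]
      ring

theorem lt_q_pow (n : ℕ) : n < (p ^ c) ^ n := Nat.lt_pow_self h.one_lt_q

theorem exists_u_sub (m n : ℕ) : ∃ l, u p ϖ ε m - u p ϖ ε n = u p ϖ ε l := by
  have hle : ∀ a b : ℕ, a ≤ b → (p ^ c) ^ a ≤ (p ^ c) ^ b :=
    fun a b hab => Nat.pow_le_pow_right h.q_pos hab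
  obtain ⟨l, -, hl⟩ := h.exists_u_sub_lt (max m n) m
    ((h.lt_q_pow m).trans_le (hle _ _ (le_max_left _ _))) n
    ((h.lt_q_pow n).trans_le (hle _ _ (le_max_right _ _)))
  exact ⟨l, hl⟩

/-- By the ultrametric inequality the top nonzero digit determines the norm, and its term has norm
at least `‖ϖ‖⁻¹`. -/
theorem one_lt_norm_u {n : ℕ} (hn : n ≠ 0) : 1 < ‖u p ϖ ε n‖ := by
  induction n using Nat.strong_induction_on with
  | _ n ih =>
    obtain ⟨b, hb, m, rfl⟩ := h.exists_eq_add_mul n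
    rw [h.u_add_mul hb, norm_mul, norm_inv]
    rcases eq_or_ne m 0 with rfl | hm
    · have hb0 : b ≠ 0 := by simpa using hn
      have : ‖residueRep p ε b‖ = 1 := by
        refine le_antisymm (h.norm_residueRep_le b) (not_lt.1 fun hlt => hb0 ?_)
        exact h.residueRep_injOn (x := 0) (by simp) hb h.q_pos (by simpa using hlt)
          (by simp [residueRep_zero])
      rw [h.u_zero, add_zero, this, mul_one]
      exact h.one_lt_inv_norm
    · have hlt : m < b + p ^ c * m := by
        have := Nat.mul_lt_mul_of_pos_right h.one_lt_q (Nat.pos_of_ne_zero hm)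
        omega
      have h1 := ih m hlt hm
      have h2 : ‖residueRep p ε b + u p ϖ ε m‖ = ‖u p ϖ ε m‖ := by
        rw [IsUltrametricDist.norm_add_eq_max_of_norm_ne_norm,
          max_eq_right ((h.norm_residueRep_le b).trans h1.le)]
        exact ((h.norm_residueRep_le b).trans_lt h1).ne
      rw [h2]
      exact one_lt_mul_of_lt_of_le h.one_lt_inv_norm h1.le

theorem norm_u_le (N : ℕ) : ∀ n < (p ^ c) ^ N, ‖u p ϖ ε n‖ ≤ ‖(ϖ : K)‖⁻¹ ^ N := by
  induction N with
  | zero => intro n hn; simp_all [h.u_zero]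
  | succ N ih =>
    intro n hn
    obtain ⟨b, hb, n, rfl⟩ := h.exists_eq_add_mul n
    rw [pow_succ'] at hn
    have h1 := ih n (lt_of_mul_lt_mul_left (by omega) (Nat.zero_le (p ^ c)))
    rw [h.u_add_mul hb, norm_mul, norm_inv, pow_succ']
    refine mul_le_mul_of_nonneg_left ?_ (by positivity)
    exact (IsUltrametricDist.norm_add_le_max _ _).trans
      (max_le ((h.norm_residueRep_le b).trans (one_le_pow₀ h.one_lt_inv_norm.le)) h1)

theorem eq_zero_of_norm_u_le {n : ℕ} (hn : ‖u p ϖ ε n‖ ≤ 1) : n = 0 := by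
  by_contra h0
  exact absurd (h.one_lt_norm_u h0) (not_lt.2 hn)

theorem u_injective : Function.Injective (u p ϖ ε) := by
  intro m
  induction m using Nat.strong_induction_on with
  | _ m ih =>
    intro n hmn
    obtain ⟨a, ha, m, rfl⟩ := h.exists_eq_add_mul m
    obtain ⟨b, hb, n, rfl⟩ := h.exists_eq_add_mul n
    rw [h.u_add_mul ha, h.u_add_mul hb] at hmn
    have h1 : residueRep p ε a + u p ϖ ε m = residueRep p ε b + u p ϖ ε n :=
      mul_left_cancel₀ (inv_ne_zero ϖ.ne_zero) hmn
    obtain ⟨l, hl⟩ := h.exists_u_sub m n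
    have h2 : residueRep p ε b - residueRep p ε a = u p ϖ ε l := by
      rw [← hl]; linear_combination -h1
    -- A difference of residue representatives is integral, whereas a nonzero index would give norm
    -- greater than one. So the lowest digits and the remaining parts agree separately.
    have hl0 : l = 0 := h.eq_zero_of_norm_u_le <| by
      rw [← h2]
      obtain ⟨e, -, he⟩ := h.exists_residueRep_sub b a
      rw [he]; exact h.norm_residueRep_le e
    rw [hl0, h.u_zero] at h2 hl
    have hab : a = b := h.residueRep_injOn (h.norm_residueRep_le b) ha hb
      (by rw [h2]; simp) (by simp)
    subst hab
    -- For `m = 0` the index need not have decreased, so the induction hypothesis may be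
    -- unavailable.
    rcases eq_or_ne m 0 with rfl | hm
    · have : n = 0 := h.eq_zero_of_norm_u_le (by
        rw [h.u_zero, zero_sub, neg_eq_zero] at hl; rw [hl]; simp)
      rw [this]
    · have hlt : m < a + p ^ c * m := by
        have := Nat.mul_lt_mul_of_pos_right h.one_lt_q (Nat.pos_of_ne_zero hm)
        omega
      rw [ih m hlt (sub_eq_zero.1 hl)]

theorem exists_norm_sub_u_le_lt (N : ℕ) : ∀ x : K, ‖x‖ ≤ ‖(ϖ : K)‖⁻¹ ^ N →
    ∃ n < (p ^ c) ^ N, ‖x - u p ϖ ε n‖ ≤ 1 := by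
  induction N with
  | zero => intro x hx; exact ⟨0, by simp, by simpa [h.u_zero] using hx⟩
  | succ N ih =>
    intro x hx
    obtain ⟨m, hm, hxm⟩ := ih ((ϖ : K) * x) (by
      rw [norm_mul]
      calc ‖(ϖ : K)‖ * ‖x‖ ≤ ‖(ϖ : K)‖ * ‖(ϖ : K)‖⁻¹ ^ (N + 1) :=
            mul_le_mul_of_nonneg_left hx (norm_nonneg _)
        _ = _ := by rw [pow_succ', mul_inv_cancel_left₀ h.norm_pos.ne'])
    obtain ⟨b, hb, hxb⟩ := h.exists_residueRep hxm
    refine ⟨b + p ^ c * m, ?_, ?_⟩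
    · rw [pow_succ']
      calc b + p ^ c * m < p ^ c + p ^ c * m := by omega
        _ = p ^ c * (m + 1) := by ring
        _ ≤ _ := Nat.mul_le_mul_left _ hm
    -- Maximality of `‖ϖ‖` improves the strict bound `< 1` to `≤ ‖ϖ‖`, which is what survives
    -- multiplication by `ϖ⁻¹`.
    · have h1 := h.isPrimeElement.2 _ hxb
      have h2 : x - u p ϖ ε (b + p ^ c * m)
          = (ϖ : K)⁻¹ * ((ϖ : K) * x - u p ϖ ε m - residueRep p ε b) := by
        rw [h.u_add_mul hb]
        field_simp
        ring
      rw [h2, norm_mul, norm_inv]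
      calc _ ≤ ‖(ϖ : K)‖⁻¹ * ‖(ϖ : K)‖ := mul_le_mul_of_nonneg_left h1 (by positivity)
        _ = 1 := inv_mul_cancel₀ h.norm_pos.ne'

theorem exists_norm_le_pow (x : K) : ∃ N : ℕ, ‖x‖ ≤ ‖(ϖ : K)‖⁻¹ ^ N :=
  (pow_unbounded_of_one_lt ‖x‖ h.one_lt_inv_norm).imp fun _ => le_of_lt

theorem exists_norm_sub_u_le (x : K) : ∃ n, ‖x - u p ϖ ε n‖ ≤ 1 := by
  obtain ⟨N, hN⟩ := h.exists_norm_le_pow x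
  obtain ⟨n, -, hn⟩ := h.exists_norm_sub_u_le_lt N x hN
  exact ⟨n, hn⟩

theorem eq_of_norm_u_sub_le {m n : ℕ} (hmn : ‖u p ϖ ε m - u p ϖ ε n‖ ≤ 1) : m = n := by
  obtain ⟨l, hl⟩ := h.exists_u_sub m n
  have hl0 : l = 0 := h.eq_zero_of_norm_u_le (by rwa [← hl])
  rw [hl0, h.u_zero, sub_eq_zero] at hl
  exact h.u_injective hl

theorem eq_of_norm_sub_u_le {x : K} {m n : ℕ} (hm : ‖x - u p ϖ ε m‖ ≤ 1)
    (hn : ‖x - u p ϖ ε n‖ ≤ 1) : m = n := by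
  apply h.eq_of_norm_u_sub_le
  rw [show u p ϖ ε m - u p ϖ ε n = (x - u p ϖ ε n) + (u p ϖ ε m - x) by ring]
  exact (IsUltrametricDist.norm_add_le_max _ _).trans (max_le hn (by rwa [norm_sub_rev]))

theorem exists_neg_u (n : ℕ) : ∃ m, u p ϖ ε m = -u p ϖ ε n := by
  obtain ⟨m, hm⟩ := h.exists_u_sub 0 n
  exact ⟨m, by rw [← hm, h.u_zero, zero_sub]⟩

theorem exists_u_add (m n : ℕ) : ∃ l, u p ϖ ε m + u p ϖ ε n = u p ϖ ε l := by
  obtain ⟨n', hn'⟩ := h.exists_neg_u n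
  obtain ⟨l, hl⟩ := h.exists_u_sub m n'
  exact ⟨l, by rw [← hl, hn', sub_neg_eq_add]⟩

end IsDigitSystem

end Arithmetic

open scoped NNReal

section LocalField

variable {K : Type*} [NontriviallyNormedField K] [LocallyCompactSpace K]

instance properSpace_of_locallyCompact : ProperSpace K := ProperSpace.of_locallyCompactSpace K

end LocalField

/-- The standing assumptions of harmonic analysis on `K`: a digit system, a normalized character
and a Haar measure giving the ring of integers mass one. -/
structure IsHarmonicSetting {K : Type*} [NormedField K] [MeasurableSpace K] (p : ℕ) {c : ℕ}
    (ϖ : Kˣ) (ε : Fin c → K) (χ : AddChar K Circle) (μ : Measure K) : Prop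
    extends IsDigitSystem p ϖ ε where
  isNormalizedCharacter : IsNormalizedCharacter p ϖ ε χ
  measure_integers : μ (Metric.closedBall (0 : K) 1) = 1

/-! ### Haar measure, orthogonality of characters, and completeness of the characters `χ(u(k)·)` on
`𝒪`. -/

section Setting

variable {K : Type*} [NontriviallyNormedField K] [IsUltrametricDist K] [LocallyCompactSpace K]
  [MeasurableSpace K] [BorelSpace K] {p c : ℕ} {ϖ : Kˣ} {ε : Fin c → K}
  {χ : AddChar K Circle} {μ : Measure K} [μ.IsAddHaarMeasure]

theorem preimage_add_right_closedBall (a : K) (r : ℝ) :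
    (fun x : K => x + a) ⁻¹' Metric.closedBall a r = Metric.closedBall 0 r := by
  ext x; simp [dist_eq_norm]

theorem setLIntegral_closedBall_eq (f : K → ℝ≥0∞) (a : K) (r : ℝ) :
    ∫⁻ x in Metric.closedBall a r, f x ∂μ = ∫⁻ x in Metric.closedBall 0 r, f (x + a) ∂μ := by
  rw [← (measurePreserving_add_right μ a).setLIntegral_comp_preimage_emb
    (measurableEmbedding_addRight a), preimage_add_right_closedBall]

theorem setIntegral_closedBall_eq (f : K → ℂ) (a : K) (r : ℝ) :
    ∫ x in Metric.closedBall a r, f x ∂μ = ∫ x in Metric.closedBall 0 r, f (x + a) ∂μ := by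
  rw [← (measurePreserving_add_right μ a).setIntegral_preimage_emb
    (measurableEmbedding_addRight a), preimage_add_right_closedBall]

/-- The character `χ` as a complex valued function. -/
noncomputable def charFn {A : Type*} [AddMonoid A] (χ : AddChar A Circle) (x : A) : ℂ := χ x

section CharFn

variable {A : Type*} [AddCommGroup A] {χ : AddChar A Circle}

theorem charFn_add (x y : A) : charFn χ (x + y) = charFn χ x * charFn χ y := by
  simp [charFn, AddChar.map_add_eq_mul]

@[simp] theorem charFn_zero : charFn χ 0 = 1 := by simp [charFn]

@[simp] theorem norm_charFn (x : A) : ‖charFn χ x‖ = 1 := Circle.norm_coe _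

theorem charFn_neg (x : A) : charFn χ (-x) = starRingEnd ℂ (charFn χ x) := by
  rw [charFn, charFn, AddChar.map_neg_eq_inv, Circle.coe_inv_eq_conj]

theorem charFn_ne_one {x : A} : charFn χ x ≠ 1 ↔ χ x ≠ 1 := not_congr Circle.coe_eq_one

end CharFn

namespace IsDigitSystem

variable (h : IsDigitSystem p ϖ ε)
include h

theorem iUnion_tile : ⋃ n, Metric.closedBall (u p ϖ ε n) 1 = Set.univ := by
  refine Set.eq_univ_of_forall fun x => ?_
  obtain ⟨n, hn⟩ := h.exists_norm_sub_u_le x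
  exact Set.mem_iUnion.2 ⟨n, by rwa [mem_closedBall_iff_norm]⟩

theorem pairwise_disjoint_tile :
    Pairwise (Function.onFun Disjoint fun n => Metric.closedBall (u p ϖ ε n) 1) := by
  intro m n hmn
  rw [Function.onFun, Set.disjoint_left]
  intro x hm hn
  rw [mem_closedBall_iff_norm] at hm hn
  exact hmn (h.eq_of_norm_sub_u_le hm hn)

theorem lintegral_eq_tsum (f : K → ℝ≥0∞) :
    ∫⁻ x, f x ∂μ = ∑' n, ∫⁻ x in Metric.closedBall 0 1, f (x + u p ϖ ε n) ∂μ := by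
  rw [← setLIntegral_univ, ← h.iUnion_tile,
    lintegral_iUnion (fun _ => Metric.isClosed_closedBall.measurableSet) h.pairwise_disjoint_tile]
  exact tsum_congr fun n => setLIntegral_closedBall_eq _ _ _

theorem hasSum_integral {f : K → ℂ} (hf : Integrable f μ) :
    HasSum (fun n => ∫ x in Metric.closedBall 0 1, f (x + u p ϖ ε n) ∂μ) (∫ x, f x ∂μ) := by
  have := hasSum_integral_iUnion (f := f) (μ := μ)
    (fun n => (Metric.isClosed_closedBall (x := u p ϖ ε n) (ε := 1)).measurableSet)
    h.pairwise_disjoint_tile hf.integrableOn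
  rw [h.iUnion_tile, setIntegral_univ] at this
  exact this.congr_fun fun n => (setIntegral_closedBall_eq _ _ _).symm

/-- The valuation is discrete: applying maximality of `‖ϖ‖` to `x⁻¹` leaves no absolute value
strictly between `1` and `‖ϖ‖⁻¹`. -/
theorem inv_norm_le_of_one_lt {x : K} (hx : 1 < ‖x‖) : ‖(ϖ : K)‖⁻¹ ≤ ‖x‖ := by
  have h1 : ‖x⁻¹‖ < 1 := by rw [norm_inv]; exact inv_lt_one_of_one_lt₀ hx
  have h2 := h.isPrimeElement.2 _ h1
  rw [norm_inv] at h2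
  exact inv_le_of_inv_le₀ (zero_lt_one.trans hx) h2

theorem norm_uniformizer_pow_le {x : K} {N : ℕ} (hx : ‖(ϖ : K)‖ ^ (N + 1) < ‖x‖) :
    ‖(ϖ : K)‖ ^ N ≤ ‖x‖ := by
  have hr := pow_pos h.norm_pos (N + 1)
  have := h.inv_norm_le_of_one_lt (x := x * ((ϖ : K) ^ (N + 1))⁻¹) (by
    rw [norm_mul, norm_inv, norm_pow, ← div_eq_mul_inv]
    exact (one_lt_div hr).2 hx)
  rw [norm_mul, norm_inv, norm_pow, ← div_eq_mul_inv, le_div_iff₀ hr, pow_succ',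
    inv_mul_cancel_left₀ h.norm_pos.ne'] at this
  exact this

theorem closedBall_inv_norm : Metric.closedBall (0 : K) ‖(ϖ : K)‖⁻¹ =
    ⋃ n ∈ Finset.range (p ^ c), Metric.closedBall (u p ϖ ε n) 1 := by
  ext x
  rw [mem_closedBall_zero_iff]
  simp only [Set.mem_iUnion, Finset.mem_range, exists_prop,
    mem_closedBall_iff_norm]
  constructor
  · intro hx
    simpa using h.exists_norm_sub_u_le_lt 1 x (by simpa using hx)
  · rintro ⟨n, hn, hx⟩
    rw [show x = (x - u p ϖ ε n) + u p ϖ ε n by ring]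
    refine (IsUltrametricDist.norm_add_le_max (x - u p ϖ ε n) _).trans (max_le ?_ ?_)
    · exact hx.trans h.one_lt_inv_norm.le
    · simpa using h.norm_u_le 1 n (by simpa using hn)

end IsDigitSystem

namespace IsHarmonicSetting

variable (h : IsHarmonicSetting p ϖ ε χ μ)
include h

theorem measure_closedBall_one (a : K) : μ (Metric.closedBall a 1) = 1 := by
  rw [← h.measure_integers, ← preimage_add_right_closedBall a, measure_preimage_add_right]

theorem measure_closedBall_inv_norm : μ (Metric.closedBall 0 ‖(ϖ : K)‖⁻¹) = (p ^ c : ℕ) := by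
  rw [h.closedBall_inv_norm, measure_biUnion_finset
    (fun m _ n _ hmn => h.pairwise_disjoint_tile hmn)
    (fun _ _ => Metric.isClosed_closedBall.measurableSet)]
  simp [h.measure_closedBall_one]

/-- The ball `ϖ⁻¹𝒪` consists of `q` tiles of measure one. -/
theorem distribHaarChar_inv : distribHaarChar K ϖ⁻¹ = ((p ^ c : ℕ) : ℝ≥0) := by
  have h1 := distribHaarChar_mul μ ϖ⁻¹ (Metric.closedBall (0 : K) 1)
  have h2 : (ϖ⁻¹ • Metric.closedBall (0 : K) 1) = Metric.closedBall 0 ‖(ϖ : K)‖⁻¹ := by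
    ext x
    rw [Set.mem_inv_smul_set_iff, mem_closedBall_zero_iff, mem_closedBall_zero_iff, Units.smul_def,
      smul_eq_mul, norm_mul, ← one_div, le_div_iff₀ h.norm_pos, mul_comm]
  rw [h2, h.measure_closedBall_inv_norm, h.measure_integers, mul_one] at h1
  exact_mod_cast h1

theorem map_smul_measure (j : ℤ) :
    Measure.map (fun x : K => ϖ ^ j • x) μ = (((p ^ c : ℕ) : ℝ≥0) ^ j) • μ := by
  have h1 : distribHaarChar K (ϖ ^ j)⁻¹ = ((p ^ c : ℕ) : ℝ≥0) ^ j := by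
    rw [← h.distribHaarChar_inv, ← inv_zpow]
    cases j with
    | ofNat n => simp
    | negSucc n =>
      have hinv : ∀ a : Kˣ, distribHaarChar K a⁻¹ = (distribHaarChar K a)⁻¹ := fun a =>
        eq_inv_of_mul_eq_one_left (by rw [← map_mul]; simp)
      rw [zpow_negSucc, zpow_negSucc, hinv, map_pow]
  ext s hs
  rw [Measure.map_apply (measurable_const_smul _) hs, Set.preimage_smul, Measure.smul_apply,
    ← distribHaarChar_mul μ (ϖ ^ j)⁻¹ s, h1]
  rfl

theorem lintegral_comp_smul (j : ℤ) (f : K → ℝ≥0∞) :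
    ∫⁻ x, f (ϖ ^ j • x) ∂μ = (((p ^ c : ℕ) : ℝ≥0) ^ j : ℝ≥0) * ∫⁻ x, f x ∂μ := by
  rw [← (measurableEmbedding_const_smul (ϖ ^ j)).lintegral_map, h.map_smul_measure, lintegral_smul_measure]
  rfl

theorem integral_comp_smul (j : ℤ) (f : K → ℂ) :
    ∫ x, f (ϖ ^ j • x) ∂μ = (((p ^ c : ℕ) : ℝ) ^ j : ℝ) • ∫ x, f x ∂μ := by
  rw [← (measurableEmbedding_const_smul (ϖ ^ j)).integral_map, h.map_smul_measure,
    integral_smul_nnreal_measure, NNReal.smul_def]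
  simp

theorem χ_eq_one {x : K} (hx : ‖x‖ ≤ 1) : χ x = 1 :=
  h.isNormalizedCharacter.trivial_on_integers x hx

theorem charFn_eq_one {x : K} (hx : ‖x‖ ≤ 1) : charFn χ x = 1 := by
  rw [charFn, h.χ_eq_one hx]; rfl

theorem continuous_char (y : K) : Continuous fun x => charFn χ (y * x) :=
  continuous_subtype_val.comp
    (h.isNormalizedCharacter.continuous.comp (continuous_const.mul continuous_id))

theorem exists_char_ne_one {z : K} {R : ℝ} (hz : 0 < ‖z‖) (hR : ‖(ϖ : K)‖⁻¹ ≤ R * ‖z‖) :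
    ∃ y : K, ‖y‖ ≤ R ∧ χ (y * z) ≠ 1 := by
  obtain ⟨x, hx, hx1⟩ := h.isNormalizedCharacter.nontrivial
  refine ⟨x * z⁻¹, ?_, by rwa [inv_mul_cancel_right₀ (norm_pos_iff.1 hz)]⟩
  rw [norm_mul, norm_inv, ← div_eq_mul_inv, div_le_iff₀ hz]
  refine le_trans ?_ hR
  rw [norm_mul] at hx
  rwa [← one_div, le_div_iff₀ h.norm_pos, mul_comm]

/-- Translating `𝒪` by some `a ∈ 𝒪` with `χ(ya) ≠ 1` multiplies the integral by `χ(ya)` without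
changing it. -/
theorem integral_char {y : K} (hy : 1 < ‖y‖) :
    ∫ x in Metric.closedBall 0 1, charFn χ (y * x) ∂μ = 0 := by
  obtain ⟨a, ha, hne⟩ := h.exists_char_ne_one (z := y) (R := 1) (zero_lt_one.trans hy)
    (by simpa using h.inv_norm_le_of_one_lt hy)
  have h1 : Metric.closedBall (0 : K) 1 = Metric.closedBall a 1 :=
    IsUltrametricDist.closedBall_eq_of_mem (by simpa using ha)
  have h2 := setIntegral_closedBall_eq (μ := μ) (fun x => charFn χ (y * x)) a 1
  rw [← h1] at h2
  simp only [mul_add, charFn_add] at h2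
  rw [integral_mul_const] at h2
  have h3 : charFn χ (y * a) ≠ 1 := by
    rw [mul_comm y a]; exact charFn_ne_one.2 hne
  have h4 : (∫ x in Metric.closedBall 0 1, charFn χ (y * x) ∂μ) * (1 - charFn χ (y * a)) = 0 := by
    linear_combination h2
  exact (mul_eq_zero.1 h4).resolve_right (sub_ne_zero.2 h3.symm)

theorem integral_char_of_le {y : K} (hy : ‖y‖ ≤ 1) :
    ∫ x in Metric.closedBall 0 1, charFn χ (y * x) ∂μ = 1 := by
  rw [setIntegral_congr_fun (g := fun _ => (1 : ℂ)) Metric.isClosed_closedBall.measurableSet]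
  · simp [Measure.real, h.measure_integers]
  · intro x hx
    rw [mem_closedBall_zero_iff] at hx
    simp [h.charFn_eq_one (x := y * x) (by rw [norm_mul]; exact mul_le_one₀ hy (norm_nonneg _) hx)]

theorem sum_char_of_le (N : ℕ) {z : K} (hz : ‖z‖ ≤ ‖(ϖ : K)‖ ^ N) :
    ∑ k ∈ Finset.range ((p ^ c) ^ N), charFn χ (u p ϖ ε k * z) = ((p ^ c) ^ N : ℕ) := by
  rw [Finset.sum_congr rfl (g := fun _ => (1 : ℂ))]
  · simp
  · intro k hk
    refine h.charFn_eq_one ?_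
    rw [norm_mul]
    calc _ ≤ ‖(ϖ : K)‖⁻¹ ^ N * ‖(ϖ : K)‖ ^ N := by
          gcongr; exact h.norm_u_le N k (Finset.mem_range.1 hk)
      _ = 1 := by rw [← mul_pow, inv_mul_cancel₀ h.norm_pos.ne', one_pow]

/-- The `u(k)` with `k < q ^ N` form a finite group, on which `χ(·z)` is a nontrivial character.
Together with `sum_char_of_le`, these sums detect, within `𝒪`, the ball of radius `‖ϖ‖ ^ N`. -/
theorem sum_char_of_lt (N : ℕ) {z : K} (hz1 : ‖z‖ ≤ 1) (hz : ‖(ϖ : K)‖ ^ N < ‖z‖) :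
    ∑ k ∈ Finset.range ((p ^ c) ^ N), charFn χ (u p ϖ ε k * z) = 0 := by
  have hz0 : 0 < ‖z‖ := (pow_pos h.norm_pos N).trans hz
  have hr := h.norm_pos
  obtain ⟨y, hy, hne⟩ := h.exists_char_ne_one (z := z) (R := ‖(ϖ : K)‖⁻¹ ^ N) hz0 (by
    cases N with
    | zero => exact absurd hz1 (by simpa using hz)
    | succ N =>
      calc ‖(ϖ : K)‖⁻¹ = ‖(ϖ : K)‖⁻¹ ^ (N + 1) * ‖(ϖ : K)‖ ^ N := by
            rw [pow_succ', mul_assoc, ← mul_pow, inv_mul_cancel₀ hr.ne', one_pow, mul_one]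
        _ ≤ _ := by gcongr; exact h.norm_uniformizer_pow_le hz)
  obtain ⟨k, hk, hyk⟩ := h.exists_norm_sub_u_le_lt N y hy
  -- Since `z` is integral, replacing `y` by the nearest `u(k)` does not change the character value.
  have hne' : χ (u p ϖ ε k * z) ≠ 1 := by
    rwa [show y * z = (y - u p ϖ ε k) * z + u p ϖ ε k * z by ring, AddChar.map_add_eq_mul,
      h.χ_eq_one (by rw [norm_mul]; exact mul_le_one₀ hyk (norm_nonneg _) hz1), one_mul] at hne
  -- `k'` is the index of `-u(k)`, so subtracting `u(k')` permutes the finite group by adding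
  -- `u(k)`.
  obtain ⟨k', hk', hkk'⟩ := h.exists_u_sub_lt N 0 (pow_pos h.q_pos N) k hk
  choose! σ hσ using fun l (hl : l < (p ^ c) ^ N) => h.exists_u_sub_lt N l hl k' hk'
  have hσ' : ∀ l < (p ^ c) ^ N, u p ϖ ε (σ l) = u p ϖ ε l + u p ϖ ε k := fun l hl => by
    rw [← (hσ l hl).2, ← hkk', h.u_zero]; ring
  have hmaps : Set.MapsTo σ (Finset.range ((p ^ c) ^ N)) (Finset.range ((p ^ c) ^ N)) :=
    fun l hl => by simpa using (hσ l (by simpa using hl)).1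
  have hinj : Set.InjOn σ (Finset.range ((p ^ c) ^ N)) := fun l hl m hm hlm => by
    have h1 := hσ' l (by simpa using hl)
    rw [hlm, hσ' m (by simpa using hm)] at h1
    exact h.u_injective (add_right_cancel h1).symm
  have key : ∑ l ∈ Finset.range ((p ^ c) ^ N), charFn χ (u p ϖ ε l * z) * charFn χ (u p ϖ ε k * z) =
      ∑ l ∈ Finset.range ((p ^ c) ^ N), charFn χ (u p ϖ ε l * z) := by
    refine Finset.sum_nbij σ hmaps hinj
      (Finset.surjOn_of_injOn_of_card_le σ hmaps hinj le_rfl) fun l hl => ?_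
    rw [hσ' l (by simpa using hl), add_mul, charFn_add]
  rw [← Finset.sum_mul] at key
  have h3 : charFn χ (u p ϖ ε k * z) ≠ 1 := charFn_ne_one.2 hne'
  have h4 : (∑ l ∈ Finset.range ((p ^ c) ^ N), charFn χ (u p ϖ ε l * z)) *
      (1 - charFn χ (u p ϖ ε k * z)) = 0 := by linear_combination -key
  exact (mul_eq_zero.1 h4).resolve_right (sub_ne_zero.2 h3.symm)

/-- On `𝒪` the indicator of a ball of radius `‖ϖ‖ ^ N` about a point of `𝒪` is the average of the
characters `χ(u(k)(x - a))`, `k < q ^ N`. A ball centred outside `𝒪` misses `𝒪`. -/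
theorem setIntegral_closedBall_eq_zero {f : K → ℂ} (hf : IntegrableOn f (Metric.closedBall 0 1) μ)
    (hf0 : ∀ k, ∫ x in Metric.closedBall 0 1, charFn χ (u p ϖ ε k * x) * f x ∂μ = 0)
    (a : K) (N : ℕ) :
    ∫ x in Metric.closedBall a (‖(ϖ : K)‖ ^ N), f x ∂(μ.restrict (Metric.closedBall 0 1)) = 0 := by
  have hr1 : ‖(ϖ : K)‖ ^ N ≤ 1 := pow_le_one₀ h.norm_pos.le h.norm_lt_one.le
  have hm : MeasurableSet (Metric.closedBall a (‖(ϖ : K)‖ ^ N)) :=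
    Metric.isClosed_closedBall.measurableSet
  by_cases ha : ‖a‖ ≤ 1
  · rw [← integral_indicator hm]
    have hq : (((p ^ c) ^ N : ℕ) : ℂ) ≠ 0 := Nat.cast_ne_zero.2 (pow_pos h.q_pos N).ne'
    have key : ∀ x ∈ Metric.closedBall (0 : K) 1,
        (Metric.closedBall a (‖(ϖ : K)‖ ^ N)).indicator f x = (((p ^ c) ^ N : ℕ) : ℂ)⁻¹ *
          ∑ k ∈ Finset.range ((p ^ c) ^ N),
            charFn χ (-(u p ϖ ε k * a)) * (charFn χ (u p ϖ ε k * x) * f x) := by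
      intro x hx
      rw [mem_closedBall_zero_iff] at hx
      have h1 : ∀ k, charFn χ (-(u p ϖ ε k * a)) * (charFn χ (u p ϖ ε k * x) * f x) =
          charFn χ (u p ϖ ε k * (x - a)) * f x := fun k => by
        rw [← mul_assoc, ← charFn_add]
        congr 2; ring
      simp_rw [h1, ← Finset.sum_mul]
      by_cases hxa : x ∈ Metric.closedBall a (‖(ϖ : K)‖ ^ N)
      · rw [Set.indicator_of_mem hxa, h.sum_char_of_le N (by rwa [mem_closedBall_iff_norm] at hxa),
          inv_mul_cancel_left₀ hq]
      · rw [Set.indicator_of_notMem hxa, h.sum_char_of_lt N _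
          (by rwa [mem_closedBall_iff_norm, not_le] at hxa)]
        · simp
        · rw [sub_eq_add_neg]
          exact (IsUltrametricDist.norm_add_le_max _ _).trans (max_le hx (by rwa [norm_neg]))
    rw [setIntegral_congr_fun Metric.isClosed_closedBall.measurableSet key, integral_const_mul,
      integral_finsetSum]
    · simp [integral_const_mul, hf0]
    · intro k _
      refine Integrable.const_mul (hf.bdd_mul (c := 1) ?_ ?_) _
      · exact (h.continuous_char _).aestronglyMeasurable
      · exact Eventually.of_forall fun x => by simp
  · rw [Measure.restrict_restrict hm, Set.disjoint_iff_inter_eq_empty.1, setIntegral_empty]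
    rw [Set.disjoint_left]
    intro x hx hx0
    rw [mem_closedBall_iff_norm] at hx
    rw [mem_closedBall_zero_iff] at hx0
    apply ha
    rw [show a = x + -(x - a) by ring]
    exact (IsUltrametricDist.norm_add_le_max _ _).trans
      (max_le hx0 (by rw [norm_neg]; exact hx.trans hr1))

theorem borel_eq_generateFrom_closedBall : ‹MeasurableSpace K› = MeasurableSpace.generateFrom
    {s | ∃ (a : K) (N : ℕ), s = Metric.closedBall a (‖(ϖ : K)‖ ^ N)} := by
  rw [BorelSpace.measurable_eq (α := K)]
  refine TopologicalSpace.IsTopologicalBasis.borel_eq_generateFrom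
    (TopologicalSpace.isTopologicalBasis_of_isOpen_of_nhds ?_ ?_)
  · rintro _ ⟨a, N, rfl⟩
    exact IsUltrametricDist.isOpen_closedBall _ (pow_pos h.norm_pos N).ne'
  · intro a U ha hU
    obtain ⟨δ, hδ, hsub⟩ := Metric.isOpen_iff.1 hU a ha
    obtain ⟨N, hN⟩ := exists_pow_lt_of_lt_one hδ h.norm_lt_one
    exact ⟨_, ⟨a, N, rfl⟩, Metric.mem_closedBall_self (pow_pos h.norm_pos N).le,
      (Metric.closedBall_subset_ball hN).trans hsub⟩

/-- Balls of radius `‖ϖ‖ ^ N` are nested or disjoint, hence a π-system generating the Borel sets, so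
vanishing integrals extend from balls to all measurable sets. The coefficient with `k = 0` handles
complements. -/
theorem ae_eq_zero_of_coeff_eq_zero {f : K → ℂ} (hf : IntegrableOn f (Metric.closedBall 0 1) μ)
    (hf0 : ∀ k, ∫ x in Metric.closedBall 0 1, charFn χ (u p ϖ ε k * x) * f x ∂μ = 0) :
    f =ᵐ[μ.restrict (Metric.closedBall 0 1)] 0 := by
  refine Integrable.ae_eq_zero_of_forall_setIntegral_eq_zero hf fun s hs _ => ?_
  have huniv : ∫ x, f x ∂(μ.restrict (Metric.closedBall 0 1)) = 0 := by
    simpa [h.u_zero] using hf0 0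
  refine MeasurableSpace.induction_on_inter
    (C := fun t _ => ∫ x in t, f x ∂(μ.restrict (Metric.closedBall 0 1)) = 0)
    h.borel_eq_generateFrom_closedBall ?_ (by simp) ?_ ?_ ?_ s hs
  · rintro _ ⟨a, M, rfl⟩ _ ⟨b, N, rfl⟩ ⟨x, hxa, hxb⟩
    rw [IsUltrametricDist.closedBall_eq_of_mem hxa, IsUltrametricDist.closedBall_eq_of_mem hxb]
    rcases le_total M N with hMN | hMN
    · rw [Set.inter_eq_right.2 (Metric.closedBall_subset_closedBall
        (pow_le_pow_of_le_one h.norm_pos.le h.norm_lt_one.le hMN))]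
      exact ⟨x, N, rfl⟩
    · rw [Set.inter_eq_left.2 (Metric.closedBall_subset_closedBall
        (pow_le_pow_of_le_one h.norm_pos.le h.norm_lt_one.le hMN))]
      exact ⟨x, M, rfl⟩
  · rintro _ ⟨a, N, rfl⟩
    exact h.setIntegral_closedBall_eq_zero hf hf0 a N
  · intro t ht h0
    have := integral_add_compl ht hf
    rwa [h0, zero_add, huniv] at this
  · intro g hd hg h0
    rw [integral_iUnion hg hd hf.integrableOn]
    simp [h0]

end IsHarmonicSetting

end Setting

/-! ### The Gabor basis and the Fourier transform on `L²(K)`. -/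

section Gabor

variable {K : Type*} [NontriviallyNormedField K] [IsUltrametricDist K] [LocallyCompactSpace K]
  [MeasurableSpace K] [BorelSpace K] {p c : ℕ} {ϖ : Kˣ} {ε : Fin c → K}
  {χ : AddChar K Circle} {μ : Measure K} [μ.IsAddHaarMeasure]

/-- The Gabor functions `1_{u(k) + 𝒪}(x) χ(u(l) x)`. -/
noncomputable def gabor (p : ℕ) {c : ℕ} (ϖ : Kˣ) (ε : Fin c → K) (χ : AddChar K Circle)
    (i : ℕ × ℕ) : K → ℂ :=
  (Metric.closedBall (u p ϖ ε i.1) 1).indicator fun x => charFn χ (u p ϖ ε i.2 * x)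

theorem measurableSet_closedBall' (a : K) (r : ℝ) : MeasurableSet (Metric.closedBall a r) :=
  Metric.isClosed_closedBall.measurableSet

theorem memLp_comp_add_right {f : K → ℂ} (hf : MemLp f 2 μ) (a : K) :
    MemLp (fun x => f (x + a)) 2 μ :=
  hf.comp_measurePreserving (measurePreserving_add_right μ a)

theorem integrableOn_closedBall {f : K → ℂ} (hf : MemLp f 2 μ) (a : K) (r : ℝ) :
    IntegrableOn f (Metric.closedBall a r) μ :=
  have : IsFiniteMeasure (μ.restrict (Metric.closedBall a r)) :=
    ⟨by simpa using (isCompact_closedBall a r).measure_lt_top⟩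
  (hf.restrict _).integrable one_le_two

namespace IsHarmonicSetting

variable (h : IsHarmonicSetting p ϖ ε χ μ)
include h

theorem charFn_eq_one_of_u (k l : ℕ) : charFn χ (u p ϖ ε k * u p ϖ ε l) = 1 := by
  rw [charFn, h.isNormalizedCharacter.self_dual k l]; rfl

theorem memLp_indicator_char (a : K) (r : ℝ) (y : K) :
    MemLp ((Metric.closedBall a r).indicator fun x => charFn χ (y * x)) 2 μ := by
  have : IsFiniteMeasure (μ.restrict (Metric.closedBall a r)) :=
    ⟨by simpa using (isCompact_closedBall a r).measure_lt_top⟩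
  rw [memLp_indicator_iff_restrict (measurableSet_closedBall' a r)]
  exact MemLp.of_bound (h.continuous_char y).aestronglyMeasurable 1
    (Eventually.of_forall fun x => by simp)

theorem memLp_gabor (i : ℕ × ℕ) : MemLp (gabor p ϖ ε χ i) 2 μ := h.memLp_indicator_char _ _ _

/-- The Gabor functions as elements of `L²(K)`. -/
noncomputable def gaborLp (i : ℕ × ℕ) : Lp ℂ 2 μ := (h.memLp_gabor i).toLp

theorem coeFn_gaborLp (i : ℕ × ℕ) : h.gaborLp i =ᵐ[μ] gabor p ϖ ε χ i :=
  (h.memLp_gabor i).coeFn_toLp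

theorem inner_indicator_char (a : K) (r : ℝ) (y : K) (f : Lp ℂ 2 μ) :
    inner ℂ (h.memLp_indicator_char a r y).toLp f =
      ∫ x in Metric.closedBall a r, charFn χ (-(y * x)) * f x ∂μ := by
  rw [L2.inner_def, ← integral_indicator (measurableSet_closedBall' a r)]
  refine integral_congr_ae ?_
  filter_upwards [(h.memLp_indicator_char a r y).coeFn_toLp] with x hx
  rw [hx, RCLike.inner_apply]
  by_cases hxa : x ∈ Metric.closedBall a r
  · rw [Set.indicator_of_mem hxa, Set.indicator_of_mem hxa, charFn_neg, mul_comm]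
  · rw [Set.indicator_of_notMem hxa, Set.indicator_of_notMem hxa, map_zero, mul_zero]

theorem inner_gaborLp (i : ℕ × ℕ) (f : Lp ℂ 2 μ) : inner ℂ (h.gaborLp i) f =
    ∫ x in Metric.closedBall (u p ϖ ε i.1) 1, charFn χ (-(u p ϖ ε i.2 * x)) * f x ∂μ :=
  h.inner_indicator_char _ _ _ f

theorem integral_char_closedBall (a y : K) :
    ∫ x in Metric.closedBall a 1, charFn χ (y * x) ∂μ =
      (Metric.closedBall 0 1).indicator (fun y => charFn χ (y * a)) y := by
  rw [setIntegral_closedBall_eq]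
  simp_rw [mul_add, charFn_add]
  rw [integral_mul_const]
  by_cases hy : ‖y‖ ≤ 1
  · rw [h.integral_char_of_le hy, one_mul, Set.indicator_of_mem (by simpa using hy)]
  · rw [h.integral_char (not_le.1 hy), zero_mul, Set.indicator_of_notMem (by simpa using hy)]

theorem inner_gaborLp_gaborLp (i j : ℕ × ℕ) :
    inner ℂ (h.gaborLp i) (h.gaborLp j) = if i = j then (1 : ℂ) else 0 := by
  rw [h.inner_gaborLp]
  have h1 : ∫ x in Metric.closedBall (u p ϖ ε i.1) 1, charFn χ (-(u p ϖ ε i.2 * x)) *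
      h.gaborLp j x ∂μ = ∫ x in Metric.closedBall (u p ϖ ε i.1) 1,
        charFn χ (-(u p ϖ ε i.2 * x)) * gabor p ϖ ε χ j x ∂μ :=
    integral_congr_ae (ae_restrict_of_ae ((h.coeFn_gaborLp j).mono fun x hx => by
      simp only [hx]))
  rw [h1]
  by_cases hij : i.1 = j.1
  · rw [setIntegral_congr_fun (g := fun x => charFn χ ((u p ϖ ε j.2 - u p ϖ ε i.2) * x))
      (measurableSet_closedBall' _ _), h.integral_char_closedBall]
    · by_cases hij2 : i.2 = j.2
      · rw [if_pos (Prod.ext hij hij2), hij2, sub_self, Set.indicator_of_mem (by simp)]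
        simp
      · rw [if_neg (fun H => hij2 (congrArg Prod.snd H)), Set.indicator_of_notMem]
        rw [mem_closedBall_zero_iff]
        exact fun H => hij2 (h.eq_of_norm_u_sub_le H).symm
    · intro x hx
      rw [hij] at hx
      simp only [gabor, Set.indicator_of_mem hx]
      rw [← charFn_add]
      congr 1; ring
  · rw [if_neg (fun H => hij (congrArg Prod.fst H)), setIntegral_congr_fun (g := fun _ => (0 : ℂ))
      (measurableSet_closedBall' _ _)]
    · simp
    · intro x hx
      have : x ∉ Metric.closedBall (u p ϖ ε j.1) 1 :=
        Set.disjoint_left.1 (h.pairwise_disjoint_tile hij) hx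
      simp only [gabor, Set.indicator_of_notMem this, mul_zero]

theorem orthonormal_gaborLp : Orthonormal ℂ h.gaborLp := by
  classical
  rw [orthonormal_iff_ite]
  exact h.inner_gaborLp_gaborLp

/-- After a tile is translated to `𝒪`, self-duality removes the factor `χ(u(l)u(k))`, and the Gabor
coefficients become Fourier coefficients on `𝒪`. -/
theorem eq_zero_of_inner_gaborLp {f : Lp ℂ 2 μ} (hf : ∀ i, inner ℂ (h.gaborLp i) f = 0) :
    f = 0 := by
  have h1 : ∀ k, (fun x => f (x + u p ϖ ε k)) =ᵐ[μ.restrict (Metric.closedBall 0 1)] 0 := by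
    intro k
    refine h.ae_eq_zero_of_coeff_eq_zero
      (integrableOn_closedBall (memLp_comp_add_right (Lp.memLp f) _) _ _) fun l => ?_
    obtain ⟨l', hl'⟩ := h.exists_neg_u l
    have h2 := hf (k, l')
    rw [h.inner_gaborLp, setIntegral_closedBall_eq] at h2
    refine Eq.trans (integral_congr_ae (Eventually.of_forall fun x => ?_)) h2
    simp only
    rw [hl', neg_mul, neg_neg, mul_add, charFn_add, h.charFn_eq_one_of_u, mul_one]
  have h2 : ∫⁻ x, ‖f x‖ₑ ∂μ = 0 := by
    rw [h.lintegral_eq_tsum]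
    refine ENNReal.tsum_eq_zero.2 fun k => ?_
    rw [lintegral_congr_ae ((h1 k).mono fun x hx => by
      show ‖f (x + u p ϖ ε k)‖ₑ = 0
      simpa using hx)]
    simp
  rw [lintegral_eq_zero_iff' (Lp.aestronglyMeasurable f).enorm] at h2
  exact (Lp.eq_zero_iff_ae_eq_zero).2 (h2.mono fun x hx => by simpa using hx)

theorem span_gaborLp_orthogonal (σ : ℕ × ℕ ≃ ℕ × ℕ) :
    (Submodule.span ℂ (Set.range (h.gaborLp ∘ σ)))ᗮ = ⊥ := by
  rw [eq_bot_iff]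
  intro f hf
  rw [Submodule.mem_orthogonal] at hf
  refine h.eq_zero_of_inner_gaborLp fun i => hf _ (Submodule.subset_span ⟨σ.symm i, by simp⟩)

/-- The Gabor basis of `L²(K)`, reindexed by `σ`. -/
noncomputable def gaborBasis (σ : ℕ × ℕ ≃ ℕ × ℕ) : HilbertBasis (ℕ × ℕ) ℂ (Lp ℂ 2 μ) :=
  HilbertBasis.mkOfOrthogonalEqBot (h.orthonormal_gaborLp.comp σ σ.injective)
    (h.span_gaborLp_orthogonal σ)

theorem gaborBasis_apply (σ : ℕ × ℕ ≃ ℕ × ℕ) (i : ℕ × ℕ) :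
    h.gaborBasis σ i = h.gaborLp (σ i) := by
  rw [gaborBasis, HilbertBasis.coe_mkOfOrthogonalEqBot]; rfl

/-- The index of `-u(n)`. -/
noncomputable def negIndex (n : ℕ) : ℕ := (h.exists_neg_u n).choose

theorem u_negIndex (n : ℕ) : u p ϖ ε (h.negIndex n) = -u p ϖ ε n := (h.exists_neg_u n).choose_spec

theorem negIndex_negIndex (n : ℕ) : h.negIndex (h.negIndex n) = n :=
  h.u_injective (by rw [u_negIndex, u_negIndex, neg_neg])

/-- The Fourier transform maps the Gabor function with index `(k, l)` to the one with index
`(l, -k)`. -/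
noncomputable def swapNeg : ℕ × ℕ ≃ ℕ × ℕ where
  toFun i := (i.2, h.negIndex i.1)
  invFun i := (h.negIndex i.2, i.1)
  left_inv i := by simp [h.negIndex_negIndex]
  right_inv i := by simp [h.negIndex_negIndex]

/-- The Fourier transform on `L²(K)`. -/
noncomputable def fourierL2 : Lp ℂ 2 μ ≃ₗᵢ[ℂ] Lp ℂ 2 μ :=
  (h.gaborBasis (Equiv.refl _)).repr.trans (h.gaborBasis h.swapNeg).repr.symm

theorem fourierL2_gaborLp (i : ℕ × ℕ) : h.fourierL2 (h.gaborLp i) = h.gaborLp (h.swapNeg i) := by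
  classical
  have h1 : h.gaborLp i = h.gaborBasis (Equiv.refl _) i := by rw [gaborBasis_apply]; rfl
  rw [fourierL2, LinearIsometryEquiv.trans_apply, h1, HilbertBasis.repr_self,
    HilbertBasis.repr_symm_single, gaborBasis_apply]

theorem hasSum_gaborLp (f : Lp ℂ 2 μ) :
    HasSum (fun i => inner ℂ (h.gaborLp i) f • h.gaborLp i) f := by
  have := (h.gaborBasis (Equiv.refl _)).hasSum_repr f
  simpa [HilbertBasis.repr_apply_apply, gaborBasis_apply] using this

theorem clm_ext {A B : Lp ℂ 2 μ →L[ℂ] Lp ℂ 2 μ} (hAB : ∀ i, A (h.gaborLp i) = B (h.gaborLp i)) :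
    A = B := by
  ext1 f
  have hA := (h.hasSum_gaborLp f).mapL A
  have hB := (h.hasSum_gaborLp f).mapL B
  exact hA.unique (hB.congr_fun fun i => by rw [map_smul, map_smul, hAB])

theorem fourierIntegral_eq (f : K → ℂ) (ξ : K) :
    Fourier.fourierIntegral χ μ f ξ = ∫ x, charFn χ (-(x * ξ)) * f x ∂μ := by
  rw [Fourier.fourierIntegral_def]; rfl

theorem fourierIntegral_congr_ae {f g : K → ℂ} (hfg : f =ᵐ[μ] g) (ξ : K) :
    Fourier.fourierIntegral χ μ f ξ = Fourier.fourierIntegral χ μ g ξ := by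
  rw [h.fourierIntegral_eq, h.fourierIntegral_eq]
  exact integral_congr_ae (hfg.mono fun x hx => by simp only [hx])

/-- For `i = (k, l)`, integrating `χ((u(l) - ξ)x)` over `u(k) + 𝒪` gives zero unless `ξ ∈ u(l) + 𝒪`,
and `χ((u(l) - ξ)u(k))` there. Self-duality leaves only `χ(-u(k)ξ)`. This justifies defining
`fourierL2` by permuting the basis. -/
theorem fourierIntegral_gabor (i : ℕ × ℕ) (ξ : K) :
    Fourier.fourierIntegral χ μ (gabor p ϖ ε χ i) ξ = gabor p ϖ ε χ (h.swapNeg i) ξ := by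
  have h1 : ∀ x, charFn χ (-(x * ξ)) * gabor p ϖ ε χ i x =
      (Metric.closedBall (u p ϖ ε i.1) 1).indicator
        (fun x => charFn χ ((u p ϖ ε i.2 - ξ) * x)) x := by
    intro x
    rw [gabor]
    by_cases hx : x ∈ Metric.closedBall (u p ϖ ε i.1) 1
    · rw [Set.indicator_of_mem hx, Set.indicator_of_mem hx, ← charFn_add]
      congr 1; ring
    · rw [Set.indicator_of_notMem hx, Set.indicator_of_notMem hx, mul_zero]
  rw [h.fourierIntegral_eq]
  simp_rw [h1]
  rw [integral_indicator (measurableSet_closedBall' _ _), h.integral_char_closedBall]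
  have h2 : u p ϖ ε i.2 - ξ ∈ Metric.closedBall (0 : K) 1 ↔
      ξ ∈ Metric.closedBall (u p ϖ ε i.2) 1 := by
    rw [mem_closedBall_zero_iff, mem_closedBall_iff_norm, norm_sub_rev]
  simp only [gabor, swapNeg, Equiv.coe_fn_mk]
  by_cases hξ : ξ ∈ Metric.closedBall (u p ϖ ε i.2) 1
  · rw [Set.indicator_of_mem (h2.2 hξ), Set.indicator_of_mem hξ, h.u_negIndex, sub_mul,
      sub_eq_add_neg, charFn_add, h.charFn_eq_one_of_u, one_mul, neg_mul, mul_comm]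
  · rw [Set.indicator_of_notMem (mt h2.1 hξ), Set.indicator_of_notMem hξ]

theorem fourierL2_gaborLp_ae (i : ℕ × ℕ) :
    h.fourierL2 (h.gaborLp i) =ᵐ[μ] Fourier.fourierIntegral χ μ (gabor p ϖ ε χ i) := by
  rw [h.fourierL2_gaborLp]
  exact (h.coeFn_gaborLp _).mono fun ξ hξ => by rw [hξ, h.fourierIntegral_gabor]

/-- For boundedly supported `f` the Fourier integral at `ξ` is an inner product with a truncated
character in `L²`, so the Gabor expansion may be integrated term by term at every `ξ`. -/
theorem hasSum_fourierIntegral {f : Lp ℂ 2 μ} {R : ℝ}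
    (hf : ∀ᵐ x ∂μ, x ∉ Metric.closedBall 0 R → f x = 0) (ξ : K) :
    HasSum (fun i => inner ℂ (h.gaborLp i) f * gabor p ϖ ε χ (h.swapNeg i) ξ)
      (Fourier.fourierIntegral χ μ f ξ) := by
  -- For radius at least one, each tile is contained in the ball or disjoint from it.
  wlog hR : 1 ≤ R generalizing R
  · exact this (R := max R 1) (hf.mono fun x hx hx' => hx fun H => hx'
      (Metric.closedBall_subset_closedBall (le_max_left _ _) H)) (le_max_right _ _)
  have key : ∀ g : Lp ℂ 2 μ, (∀ᵐ x ∂μ, x ∉ Metric.closedBall 0 R → g x = 0) →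
      inner ℂ (h.memLp_indicator_char 0 R ξ).toLp g = Fourier.fourierIntegral χ μ g ξ := by
    intro g hg
    rw [h.inner_indicator_char, h.fourierIntegral_eq,
      ← integral_indicator (measurableSet_closedBall' _ _)]
    refine integral_congr_ae (hg.mono fun x hx => ?_)
    by_cases hxR : x ∈ Metric.closedBall 0 R
    · simp only [Set.indicator_of_mem hxR, mul_comm ξ x]
    · simp only [Set.indicator_of_notMem hxR, hx hxR, mul_zero]
  have h1 := (h.hasSum_gaborLp f).mapL (innerSL ℂ (h.memLp_indicator_char 0 R ξ).toLp)
  rw [innerSL_apply_apply, key f hf] at h1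
  refine h1.congr_fun fun i => ?_
  rw [innerSL_apply_apply, inner_smul_right]
  by_cases hi : Metric.closedBall (u p ϖ ε i.1) 1 ⊆ Metric.closedBall 0 R
  · rw [key, h.fourierIntegral_congr_ae (h.coeFn_gaborLp i), h.fourierIntegral_gabor]
    filter_upwards [h.coeFn_gaborLp i] with x hx hxR
    rw [hx, gabor, Set.indicator_of_notMem (fun H => hxR (hi H))]
  · have hd : Disjoint (Metric.closedBall (u p ϖ ε i.1) 1) (Metric.closedBall 0 R) := by
      rw [Set.disjoint_left]
      intro x hx hxR
      apply hi
      rw [IsUltrametricDist.closedBall_eq_of_mem hx, IsUltrametricDist.closedBall_eq_of_mem hxR]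
      exact Metric.closedBall_subset_closedBall hR
    have h0 : inner ℂ (h.gaborLp i) f = 0 := by
      rw [h.inner_gaborLp, setIntegral_congr_ae (g := fun _ => 0) (measurableSet_closedBall' _ _)]
      · simp
      · filter_upwards [hf] with x hx hxi
        rw [hx (Set.disjoint_left.1 hd hxi), mul_zero]
    rw [h0, zero_mul, zero_mul]

/-- The partial sums converge in `L²` to `fourierL2 f` and pointwise to the Fourier integral. An
a.e. convergent subsequence identifies the two limits. -/
theorem fourierL2_ae_eq {f : Lp ℂ 2 μ} {R : ℝ}
    (hf : ∀ᵐ x ∂μ, x ∉ Metric.closedBall 0 R → f x = 0) :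
    h.fourierL2 f =ᵐ[μ] Fourier.fourierIntegral χ μ f := by
  have h1 := (h.hasSum_gaborLp f).mapL
    (h.fourierL2.toContinuousLinearEquiv : Lp ℂ 2 μ →L[ℂ] Lp ℂ 2 μ)
  have h2 : HasSum (fun i => inner ℂ (h.gaborLp i) f • h.gaborLp (h.swapNeg i))
      (h.fourierL2 f) := by
    refine h1.congr_fun fun i => ?_
    simp [h.fourierL2_gaborLp]
  obtain ⟨s, hs, hs'⟩ := (tendstoInMeasure_of_tendsto_Lp h2).exists_seq_tendsto_ae'
  have h3 : ∀ᵐ ξ ∂μ, ∀ i, h.gaborLp i ξ = gabor p ϖ ε χ i ξ := ae_all_iff.2 h.coeFn_gaborLp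
  have h4 : ∀ᵐ ξ ∂μ, ∀ t : Finset (ℕ × ℕ),
      (∑ i ∈ t, inner ℂ (h.gaborLp i) f • h.gaborLp (h.swapNeg i) : Lp ℂ 2 μ) ξ =
        ∑ i ∈ t, inner ℂ (h.gaborLp i) f * h.gaborLp (h.swapNeg i) ξ := by
    refine ae_all_iff.2 fun t => ?_
    have h5 : ∀ᵐ ξ ∂μ, ∀ i, (inner ℂ (h.gaborLp i) f • h.gaborLp (h.swapNeg i) : Lp ℂ 2 μ) ξ =
        inner ℂ (h.gaborLp i) f * h.gaborLp (h.swapNeg i) ξ :=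
      ae_all_iff.2 fun i => Lp.coeFn_smul _ _
    filter_upwards [Lp.coeFn_finsetSum t fun i =>
      inner ℂ (h.gaborLp i) f • h.gaborLp (h.swapNeg i), h5] with ξ hξ h5ξ
    rw [hξ, Finset.sum_apply]
    exact Finset.sum_congr rfl fun i _ => h5ξ i
  filter_upwards [hs', h3, h4] with ξ h5 h6 h7
  refine tendsto_nhds_unique h5 ?_
  simp only [h7, h6]
  exact (h.hasSum_fourierIntegral hf ξ).comp hs

end IsHarmonicSetting

end Gabor

/-! ### Truncation to measurable sets in `L²`. -/

section Truncation

variable {X : Type*} [MeasurableSpace X] {μ : Measure X}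

theorem eLpNorm_two_sq (f : X → ℂ) : eLpNorm f 2 μ ^ 2 = ∫⁻ x, ‖f x‖ₑ ^ 2 ∂μ := by
  have := eLpNorm_nnreal_pow_eq_lintegral (μ := μ) (f := f) (p := 2) two_ne_zero
  simpa using this

theorem enorm_sq_eq_lintegral (f : Lp ℂ 2 μ) : ‖f‖ₑ ^ 2 = ∫⁻ x, ‖f x‖ₑ ^ 2 ∂μ := by
  rw [Lp.enorm_def, eLpNorm_two_sq]

theorem lintegral_enorm_sq_lt_top {f : X → ℂ} (hf : MemLp f 2 μ) : ∫⁻ x, ‖f x‖ₑ ^ 2 ∂μ < ∞ := by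
  rw [← eLpNorm_two_sq]
  exact ENNReal.pow_lt_top hf.eLpNorm_lt_top

theorem tendsto_eLpNorm_indicator_sub {f : X → ℂ} (hf : MemLp f 2 μ) {A : ℕ → Set X}
    (hA : ∀ n, MeasurableSet (A n)) (hfA : ∀ᵐ x ∂μ, ∀ᶠ n in atTop, x ∈ A n) :
    Tendsto (fun n => eLpNorm ((A n).indicator f - f) 2 μ) atTop (𝓝 0) := by
  have h1 : Tendsto (fun n => ∫⁻ x, ‖((A n).indicator f - f) x‖ₑ ^ 2 ∂μ) atTop
      (𝓝 (∫⁻ _, 0 ∂μ)) := by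
    refine tendsto_lintegral_of_dominated_convergence' (fun x => ‖f x‖ₑ ^ 2) (fun n => ?_)
      (fun n => ?_) (lintegral_enorm_sq_lt_top hf).ne ?_
    · exact (((hf.1.indicator (hA n)).sub hf.1).enorm).pow_const 2
    · refine Eventually.of_forall fun x => ?_
      by_cases hx : x ∈ A n
      · simp [hx]
      · simp [hx]
    · filter_upwards [hfA] with x hx
      refine tendsto_const_nhds.congr' (hx.mono fun n hn => ?_)
      simp [hn]
  simp_rw [← eLpNorm_two_sq, lintegral_zero] at h1
  have h2 := ((ENNReal.continuous_rpow_const (y := (1 / 2 : ℝ))).tendsto 0).comp h1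
  rw [ENNReal.zero_rpow_of_pos (by norm_num)] at h2
  refine h2.congr fun n => ?_
  simp only [Function.comp_apply]
  rw [← ENNReal.rpow_natCast, ← ENNReal.rpow_mul]
  norm_num

/-- The restriction of `f ∈ L²` to a measurable set, extended by zero. -/
noncomputable def cut {A : Set X} (hA : MeasurableSet A) (f : Lp ℂ 2 μ) : Lp ℂ 2 μ :=
  ((Lp.memLp f).indicator hA).toLp

theorem coeFn_cut {A : Set X} (hA : MeasurableSet A) (f : Lp ℂ 2 μ) :
    cut hA f =ᵐ[μ] A.indicator f :=
  ((Lp.memLp f).indicator hA).coeFn_toLp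

theorem enorm_cut_sub {A : Set X} (hA : MeasurableSet A) (f : Lp ℂ 2 μ) :
    ‖cut hA f - f‖ₑ = eLpNorm (A.indicator f - (f : X → ℂ)) 2 μ := by
  rw [Lp.enorm_def]
  refine eLpNorm_congr_ae ?_
  filter_upwards [Lp.coeFn_sub (cut hA f) f, coeFn_cut hA f] with x h1 h2
  rw [h1, Pi.sub_apply, Pi.sub_apply, h2]

theorem tendsto_cut (f : Lp ℂ 2 μ) {A : ℕ → Set X} (hA : ∀ n, MeasurableSet (A n))
    (hfA : ∀ᵐ x ∂μ, ∀ᶠ n in atTop, x ∈ A n) :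
    Tendsto (fun n => cut (hA n) f) atTop (𝓝 f) := by
  rw [tendsto_iff_edist_tendsto_0]
  refine (tendsto_eLpNorm_indicator_sub (Lp.memLp f) hA hfA).congr fun n => ?_
  rw [edist_eq_enorm_sub, enorm_cut_sub]

end Truncation

/-! ### Agreement with the integral definition; translations and dilations on the Fourier side. -/

section Fourier

variable {K : Type*} [NontriviallyNormedField K] [IsUltrametricDist K] [LocallyCompactSpace K]
  [MeasurableSpace K] [BorelSpace K] {p c : ℕ} {ϖ : Kˣ} {ε : Fin c → K}
  {χ : AddChar K Circle} {μ : Measure K} [μ.IsAddHaarMeasure]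

theorem coeFn_translation (y : K) (f : Lp ℂ 2 μ) :
    translation μ y f =ᵐ[μ] fun x => f (x - y) :=
  Lp.coeFn_compMeasurePreserving f (measurePreserving_sub_right μ y)

/-- Translation as a linear isometry. -/
noncomputable def translationIsometry (μ : Measure K) [μ.IsAddHaarMeasure] (y : K) :
    Lp ℂ 2 μ →ₗᵢ[ℂ] Lp ℂ 2 μ :=
  Lp.compMeasurePreservingₗᵢ ℂ (fun x => x - y) (measurePreserving_sub_right μ y)

theorem coeFn_dilation (q : ℕ) (j : ℤ) (f : Lp ℂ 2 μ) : dilation μ q ϖ j f =ᵐ[μ]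
    fun x => (((q : ℝ) ^ ((j : ℝ) / 2) : ℝ) : ℂ) * f (ϖ ^ (-j) • x) := by
  filter_upwards [Lp.coeFn_smul (((q : ℝ) ^ ((j : ℝ) / 2) : ℝ) : ℂ)
    ((memLp_comp_smul μ (ϖ ^ (-j)) (Lp.memLp f)).toLp (fun x => f (ϖ ^ (-j) • x))),
    (memLp_comp_smul μ (ϖ ^ (-j)) (Lp.memLp f)).coeFn_toLp] with x h1 h2
  refine h1.trans ?_
  rw [Pi.smul_apply, h2, smul_eq_mul]

theorem ae_comp_smul {P : K → Prop} (hP : ∀ᵐ x ∂μ, P x) (a : Kˣ) : ∀ᵐ x ∂μ, P (a • x) :=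
  (quasiMeasurePreserving_smul μ a).ae hP

theorem dilation_dilation {q : ℕ} (hq : 0 < q) (j k : ℤ) (f : Lp ℂ 2 μ) :
    dilation μ q ϖ j (dilation μ q ϖ k f) = dilation μ q ϖ (j + k) f := by
  refine Lp.ext ?_
  filter_upwards [coeFn_dilation q j (dilation μ q ϖ k f) (ϖ := ϖ),
    coeFn_dilation q (j + k) f (ϖ := ϖ), ae_comp_smul (coeFn_dilation q k f (ϖ := ϖ)) (ϖ ^ (-j))]
    with x h1 h2 h3
  rw [h1, h2, h3, ← mul_assoc, smul_smul, ← zpow_add, ← Complex.ofReal_mul,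
    ← Real.rpow_add (by exact_mod_cast hq)]
  congr 3
  · push_cast; ring_nf
  · congr 1; ring_nf

theorem dilation_zero (q : ℕ) (f : Lp ℂ 2 μ) : dilation μ q ϖ 0 f = f := by
  refine Lp.ext ?_
  filter_upwards [coeFn_dilation q 0 f (ϖ := ϖ)] with x h1
  rw [h1]; simp

namespace IsHarmonicSetting

variable (h : IsHarmonicSetting p ϖ ε χ μ)
include h

theorem eventually_mem_closedBall : ∀ᵐ x ∂μ, ∀ᶠ n : ℕ in atTop, x ∈ Metric.closedBall (0 : K) n :=
  Eventually.of_forall fun x => by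
    filter_upwards [eventually_ge_atTop ⌈‖x‖⌉₊] with n hn
    rw [mem_closedBall_zero_iff]
    exact (Nat.le_ceil _).trans (by exact_mod_cast hn)

theorem fourierL2_cut (n : ℕ) (f : Lp ℂ 2 μ) :
    h.fourierL2 (cut (measurableSet_closedBall' 0 (n : ℝ)) f) =ᵐ[μ]
      Fourier.fourierIntegral χ μ ((Metric.closedBall (0 : K) n).indicator f) := by
  have hcut := coeFn_cut (measurableSet_closedBall' (0 : K) (n : ℝ)) f
  have h1 := h.fourierL2_ae_eq (R := n)
    (hcut.mono fun x hx hx' => by rw [hx, Set.indicator_of_notMem hx'])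
  refine h1.mono fun ξ hξ => ?_
  rw [hξ]
  exact h.fourierIntegral_congr_ae hcut ξ

theorem tendsto_fourierL2 (f : Lp ℂ 2 μ) : Tendsto (fun n : ℕ => eLpNorm (fun ξ =>
      Fourier.fourierIntegral χ μ ((Metric.closedBall (0 : K) n).indicator f) ξ -
        h.fourierL2 f ξ) 2 μ) atTop (𝓝 0) := by
  have h1 := tendsto_cut f (fun n : ℕ => measurableSet_closedBall' (0 : K) n)
    h.eventually_mem_closedBall
  have h2 := tendsto_iff_edist_tendsto_0.1 ((h.fourierL2.continuous.tendsto f).comp h1)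
  refine h2.congr fun n => ?_
  rw [Function.comp_apply, edist_eq_enorm_sub, Lp.enorm_def]
  refine eLpNorm_congr_ae ?_
  filter_upwards [Lp.coeFn_sub (h.fourierL2 (cut (measurableSet_closedBall' 0 (n : ℝ)) f))
    (h.fourierL2 f), h.fourierL2_cut n f] with x h1 h2
  rw [h1, Pi.sub_apply, h2]

/-- The Fourier integrals of the truncations are the images of the truncations under `fourierL2`.
They converge to `fourierL2 f` by continuity, and `L²` limits are unique. -/
theorem isFourierTransform_iff (f : Lp ℂ 2 μ) (g : K → ℂ) :
    IsFourierTransform χ μ f g ↔ g =ᵐ[μ] h.fourierL2 f := by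
  constructor
  · rintro ⟨hg, hlim⟩
    have hmeas : ∀ n : ℕ, AEStronglyMeasurable
        (Fourier.fourierIntegral χ μ ((Metric.closedBall (0 : K) n).indicator f)) μ :=
      fun n => (Lp.aestronglyMeasurable _).congr (h.fourierL2_cut n f)
    have h1 : eLpNorm (g - (h.fourierL2 f : K → ℂ)) 2 μ = 0 := by
      refine le_antisymm (ge_of_tendsto' (f := fun n : ℕ => _)
        (by simpa using hlim.add (h.tendsto_fourierL2 f)) fun n => ?_) bot_le
      calc _ = eLpNorm ((fun ξ => Fourier.fourierIntegral χ μ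
            ((Metric.closedBall (0 : K) n).indicator f) ξ - h.fourierL2 f ξ) - fun ξ =>
          Fourier.fourierIntegral χ μ ((Metric.closedBall (0 : K) n).indicator f) ξ - g ξ) 2 μ := by
            congr 1; ext ξ; simp
        _ ≤ _ := eLpNorm_sub_le ((hmeas n).sub (Lp.aestronglyMeasurable _))
            ((hmeas n).sub hg.1) (by norm_num)
        _ = _ := add_comm _ _
    rw [eLpNorm_eq_zero_iff (hg.1.sub (Lp.aestronglyMeasurable _)) two_ne_zero] at h1
    exact h1.mono fun ξ hξ => sub_eq_zero.1 hξ
  · intro hg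
    refine ⟨(memLp_congr_ae hg).2 (Lp.memLp _), (h.tendsto_fourierL2 f).congr fun n => ?_⟩
    exact eLpNorm_congr_ae (hg.mono fun ξ hξ => by simp only [hξ])

theorem fourierModulusEq_iff (f : Lp ℂ 2 μ) (S : Set K) : FourierModulusEq χ μ f S ↔
    (fun ξ => ‖h.fourierL2 f ξ‖) =ᵐ[μ] S.indicator (fun _ => (1 : ℝ)) := by
  constructor
  · rintro ⟨g, hg, hgS⟩
    exact (((h.isFourierTransform_iff f g).1 hg).fun_comp norm).symm.trans hgS
  · exact fun hS => ⟨_, (h.isFourierTransform_iff f _).2 ae_eq_rfl, hS⟩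

theorem memLp_char_mul (y : K) (f : Lp ℂ 2 μ) : MemLp (fun ξ => charFn χ (-(y * ξ)) * f ξ) 2 μ := by
  refine (Lp.memLp f).of_le ?_ (Eventually.of_forall fun ξ => by simp)
  refine AEStronglyMeasurable.mul ?_ (Lp.aestronglyMeasurable f)
  simp_rw [← neg_mul]
  exact (h.continuous_char _).aestronglyMeasurable

/-- Multiplication by the character `ξ ↦ χ(-yξ)` as a linear isometry. -/
noncomputable def modulation (y : K) : Lp ℂ 2 μ →ₗᵢ[ℂ] Lp ℂ 2 μ where
  toFun f := (h.memLp_char_mul y f).toLp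
  map_add' f g := by
    rw [← MemLp.toLp_add]
    refine MemLp.toLp_congr _ _ ?_
    filter_upwards [Lp.coeFn_add f g] with x hx
    simp only [hx, Pi.add_apply, mul_add]
  map_smul' z f := by
    rw [RingHom.id_apply, ← MemLp.toLp_const_smul]
    refine MemLp.toLp_congr _ _ ?_
    filter_upwards [Lp.coeFn_smul z f] with x hx
    simp only [hx, Pi.smul_apply, smul_eq_mul, mul_left_comm]
  norm_map' f := by
    simp only [LinearMap.coe_mk, AddHom.coe_mk]
    rw [Lp.norm_toLp, Lp.norm_def]
    congr 1
    exact eLpNorm_congr_norm_ae (Eventually.of_forall fun x => by simp)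

theorem coeFn_modulation (y : K) (f : Lp ℂ 2 μ) :
    h.modulation y f =ᵐ[μ] fun ξ => charFn χ (-(y * ξ)) * f ξ :=
  (h.memLp_char_mul y f).coeFn_toLp

theorem gabor_eq_zero {i : ℕ × ℕ} {x : K} (hx : max 1 ‖u p ϖ ε i.1‖ < ‖x‖) :
    gabor p ϖ ε χ i x = 0 := by
  refine Set.indicator_of_notMem (fun H => not_le.2 hx ?_) _
  rw [mem_closedBall_iff_norm] at H
  rw [show x = (x - u p ϖ ε i.1) + u p ϖ ε i.1 by ring]
  exact (IsUltrametricDist.norm_add_le_max _ _).trans (max_le_max_right _ H)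

/-- Both sides are continuous in `f`, so Gabor functions suffice. They and their translates have
bounded support, where the integral formula applies. -/
theorem fourierL2_translation (y : K) (f : Lp ℂ 2 μ) :
    h.fourierL2 (translation μ y f) = h.modulation y (h.fourierL2 f) := by
  let F : Lp ℂ 2 μ →L[ℂ] Lp ℂ 2 μ := h.fourierL2.toContinuousLinearEquiv
  have : F ∘L (translationIsometry μ y).toContinuousLinearMap =
      (h.modulation y).toContinuousLinearMap ∘L F := by
    refine h.clm_ext fun i => ?_
    change h.fourierL2 (translation μ y (h.gaborLp i)) = h.modulation y (h.fourierL2 (h.gaborLp i))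
    have hae : translation μ y (h.gaborLp i) =ᵐ[μ] fun x => gabor p ϖ ε χ i (x - y) :=
      (coeFn_translation y _).trans
        ((measurePreserving_sub_right μ y).quasiMeasurePreserving.ae_eq_comp (h.coeFn_gaborLp i))
    have hsupp : ∀ᵐ x ∂μ, x ∉ Metric.closedBall (0 : K) (max (max 1 ‖u p ϖ ε i.1‖) ‖y‖) →
        translation μ y (h.gaborLp i) x = 0 := by
      refine hae.mono fun x hx hx' => ?_
      rw [mem_closedBall_zero_iff, not_le] at hx'
      rw [hx]
      refine h.gabor_eq_zero (lt_of_not_ge fun H => not_le.2 hx' ?_)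
      rw [show x = (x - y) + y by ring]
      exact (IsUltrametricDist.norm_add_le_max _ _).trans (max_le_max_right _ H)
    refine Lp.ext ?_
    filter_upwards [h.coeFn_modulation y (h.fourierL2 (h.gaborLp i)), h.fourierL2_gaborLp_ae i,
      h.fourierL2_ae_eq hsupp] with ξ h1 h2 h3
    · rw [h1, h2, h3, h.fourierIntegral_congr_ae hae, h.fourierIntegral_eq, h.fourierIntegral_eq,
        ← integral_const_mul, ← integral_sub_right_eq_self (μ := μ) (fun x =>
          charFn χ (-(y * ξ)) * (charFn χ (-(x * ξ)) * gabor p ϖ ε χ i x)) y]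
      refine integral_congr_ae (Eventually.of_forall fun x => ?_)
      simp only
      rw [← mul_assoc, ← charFn_add]
      congr 2; ring
  exact DFunLike.congr_fun this f

theorem enorm_q_rpow_sq (j : ℤ) : ‖((((p ^ c : ℕ) : ℝ) ^ ((j : ℝ) / 2) : ℝ) : ℂ)‖ₑ ^ 2 =
    ((((p ^ c : ℕ) : NNReal) ^ j : NNReal) : ℝ≥0∞) := by
  have hq : (0 : ℝ) < ((p ^ c : ℕ) : ℝ) := by exact_mod_cast h.q_pos
  rw [← ofReal_norm, Complex.norm_real, Real.norm_of_nonneg (by positivity),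
    ← ENNReal.ofReal_pow (by positivity), ← Real.rpow_natCast, ← Real.rpow_mul hq.le]
  rw [show (j : ℝ) / 2 * (2 : ℕ) = j by push_cast; ring, Real.rpow_intCast,
    ENNReal.ofReal]
  congr 1
  ext
  rw [Real.coe_toNNReal _ (by positivity)]
  simp

theorem norm_dilation (j : ℤ) (f : Lp ℂ 2 μ) : ‖dilation μ (p ^ c) ϖ j f‖ = ‖f‖ := by
  have h1 : ‖dilation μ (p ^ c) ϖ j f‖ₑ ^ 2 = ‖f‖ₑ ^ 2 := by
    rw [enorm_sq_eq_lintegral, enorm_sq_eq_lintegral]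
    calc _ = ∫⁻ x, ((((p ^ c : ℕ) : NNReal) ^ j : NNReal) : ℝ≥0∞) * ‖f (ϖ ^ (-j) • x)‖ₑ ^ 2 ∂μ := by
          refine lintegral_congr_ae ?_
          filter_upwards [coeFn_dilation (p ^ c) j f (ϖ := ϖ)] with x hx
          rw [hx, enorm_mul, mul_pow]
          congr 1
          exact h.enorm_q_rpow_sq j
      _ = _ := by
          rw [lintegral_const_mul' _ _ ENNReal.coe_ne_top,
            h.lintegral_comp_smul (-j) fun x => ‖f x‖ₑ ^ 2, ← mul_assoc, ← ENNReal.coe_mul,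
            ← zpow_add₀ (Nat.cast_ne_zero.2 h.q_pos.ne')]
          simp
  have h2 : ‖dilation μ (p ^ c) ϖ j f‖ₑ = ‖f‖ₑ := (ENNReal.pow_right_strictMono two_ne_zero).injective h1
  rw [← toReal_enorm, h2, toReal_enorm]

/-- Dilation as a linear isometry. -/
noncomputable def dilationIsometry (j : ℤ) : Lp ℂ 2 μ →ₗᵢ[ℂ] Lp ℂ 2 μ where
  toLinearMap := dilation μ (p ^ c) ϖ j
  norm_map' := h.norm_dilation j

theorem fourierL2_dilation (j : ℤ) (f : Lp ℂ 2 μ) :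
    h.fourierL2 (dilation μ (p ^ c) ϖ j f) = dilation μ (p ^ c) ϖ (-j) (h.fourierL2 f) := by
  let F : Lp ℂ 2 μ →L[ℂ] Lp ℂ 2 μ := h.fourierL2.toContinuousLinearEquiv
  have : F ∘L (h.dilationIsometry j).toContinuousLinearMap =
      (h.dilationIsometry (-j)).toContinuousLinearMap ∘L F := by
    refine h.clm_ext fun i => ?_
    change h.fourierL2 (dilation μ (p ^ c) ϖ j (h.gaborLp i)) =
      dilation μ (p ^ c) ϖ (-j) (h.fourierL2 (h.gaborLp i))
    have hq : (0 : ℝ) < ((p ^ c : ℕ) : ℝ) := by exact_mod_cast h.q_pos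
    have hae : dilation μ (p ^ c) ϖ j (h.gaborLp i) =ᵐ[μ] fun x =>
        ((((p ^ c : ℕ) : ℝ) ^ ((j : ℝ) / 2) : ℝ) : ℂ) * gabor p ϖ ε χ i (ϖ ^ (-j) • x) := by
      filter_upwards [coeFn_dilation (p ^ c) j (h.gaborLp i) (ϖ := ϖ),
        ae_comp_smul (h.coeFn_gaborLp i) (ϖ ^ (-j))] with x h1 h2
      rw [h1, h2]
    have hsupp : ∀ᵐ x ∂μ,
        x ∉ Metric.closedBall (0 : K) (‖((ϖ ^ j : Kˣ) : K)‖ * max 1 ‖u p ϖ ε i.1‖) →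
        dilation μ (p ^ c) ϖ j (h.gaborLp i) x = 0 := by
      refine hae.mono fun x hx hx' => ?_
      rw [mem_closedBall_zero_iff, not_le] at hx'
      rw [hx]
      beta_reduce
      rw [h.gabor_eq_zero, mul_zero]
      rw [Units.smul_def, smul_eq_mul, norm_mul, zpow_neg, Units.val_inv_eq_inv_val, norm_inv,
        ← div_eq_inv_mul, lt_div_iff₀ (norm_pos_iff.2 (Units.ne_zero _)), mul_comm]
      exact hx'
    refine Lp.ext ?_
    filter_upwards [coeFn_dilation (p ^ c) (-j) (h.fourierL2 (h.gaborLp i)) (ϖ := ϖ),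
      ae_comp_smul (h.fourierL2_gaborLp_ae i) (ϖ ^ (- -j)),
      h.fourierL2_ae_eq hsupp] with ξ h1 h2 h3
    · have h4 : ∀ x : K, charFn χ (-(x * ξ)) * (((((p ^ c : ℕ) : ℝ) ^ ((j : ℝ) / 2) : ℝ) : ℂ) *
          gabor p ϖ ε χ i (ϖ ^ (-j) • x)) = (fun y => ((((p ^ c : ℕ) : ℝ) ^ ((j : ℝ) / 2) : ℝ) : ℂ) *
            (charFn χ (-(y * (ϖ ^ (- -j) • ξ))) * gabor p ϖ ε χ i y)) (ϖ ^ (-j) • x) := by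
        intro x
        simp only
        rw [smul_mul_smul_comm, ← zpow_add]
        simp only [add_neg_cancel, zpow_zero, one_smul]
        ring
      rw [h1, h2, h3, h.fourierIntegral_congr_ae hae, h.fourierIntegral_eq, h.fourierIntegral_eq]
      rw [integral_congr_ae (Eventually.of_forall h4)]
      rw [h.integral_comp_smul (-j) fun y =>
        ((((p ^ c : ℕ) : ℝ) ^ ((j : ℝ) / 2) : ℝ) : ℂ) *
          (charFn χ (-(y * (ϖ ^ (- -j) • ξ))) * gabor p ϖ ε χ i y), integral_const_mul, Complex.real_smul, ← mul_assoc,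
        ← Complex.ofReal_mul]
      -- The change of variables contributes `q ^ (-j)`, and `q ^ (j/2) * q ^ (-j) = q ^ (-j/2)` is
      -- the normalization of `D^(-j)`.
      congr 2
      rw [← Real.rpow_intCast, ← Real.rpow_add hq]
      congr 1
      push_cast; ring
  exact DFunLike.congr_fun this f

end IsHarmonicSetting

end Fourier

/-! ### Parseval identities, periodization, and disjointness of translates. -/

/-- Parseval identities are handled in `[0, ∞]`, where sums and integrals interchange without
summability conditions. -/
theorem hasSum_sq_norm_iff {ι E F : Type*} [NormedAddCommGroup E] [NormedAddCommGroup F]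
    {a : ι → E} {f : F} :
    HasSum (fun i => ‖a i‖ ^ 2) (‖f‖ ^ 2) ↔ ∑' i, ‖a i‖ₑ ^ 2 = ‖f‖ₑ ^ 2 := by
  have h1 : HasSum (fun i => ‖a i‖ ^ 2) (‖f‖ ^ 2) ↔ HasSum (fun i => ‖a i‖₊ ^ 2) (‖f‖₊ ^ 2) := by
    rw [← NNReal.hasSum_coe]; simp
  have h2 : HasSum (fun i => ‖a i‖₊ ^ 2) (‖f‖₊ ^ 2) ↔
      HasSum (fun i => ‖a i‖ₑ ^ 2) (‖f‖ₑ ^ 2) := by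
    rw [← ENNReal.hasSum_coe]; simp [enorm_eq_nnnorm]
  rw [h1, h2]
  exact ⟨fun H => H.tsum_eq, fun H => H ▸ ENNReal.summable.hasSum⟩

theorem hilbertBasis_tsum_enorm_inner_sq {ι E : Type*} [NormedAddCommGroup E]
    [InnerProductSpace ℂ E] (b : HilbertBasis ι ℂ E) (f : E) :
    ∑' i, ‖inner ℂ (b i) f‖ₑ ^ 2 = ‖f‖ₑ ^ 2 := by
  rw [← hasSum_sq_norm_iff]
  have h1 := (b.hasSum_inner_mul_inner f f).mapL Complex.reCLM
  have h2 : Complex.reCLM (inner ℂ f f) = ‖f‖ ^ 2 := by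
    rw [inner_self_eq_norm_sq_to_K, Complex.reCLM_apply]; norm_cast
  rw [h2] at h1
  refine h1.congr_fun fun i => ?_
  rw [← inner_conj_symm f (b i), RCLike.conj_mul, Complex.reCLM_apply]; norm_cast

section Periodization

variable {K : Type*} [NontriviallyNormedField K] [IsUltrametricDist K] [LocallyCompactSpace K]
  [MeasurableSpace K] [BorelSpace K] {p c : ℕ} {ϖ : Kˣ} {ε : Fin c → K}
  {χ : AddChar K Circle} {μ : Measure K} [μ.IsAddHaarMeasure]

/-- Up to null sets, the translates of `S` by the `u(n)` are pairwise disjoint. -/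
def TranslatesDisjoint (p : ℕ) {c : ℕ} (ϖ : Kˣ) (ε : Fin c → K) (μ : Measure K) (S : Set K) :
    Prop :=
  ∀ᵐ x ∂μ, ∀ m n, x + u p ϖ ε m ∈ S → x + u p ϖ ε n ∈ S → m = n

namespace IsHarmonicSetting

variable (h : IsHarmonicSetting p ϖ ε χ μ)
include h

/-- The point `x + u(m)` lies in `S` when `x` lies in the translate of `S` by `-u(m)`, so indices
pass through `negIndex`. Countability of the index set lets the null sets be combined. -/
theorem translatesDisjoint_iff {S : Set K} : TranslatesDisjoint p ϖ ε μ S ↔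
    Pairwise (fun k l : ℕ => AEDisjoint μ (u p ϖ ε k +ᵥ S) (u p ϖ ε l +ᵥ S)) := by
  have hmem : ∀ (k : ℕ) (x : K), x ∈ u p ϖ ε k +ᵥ S ↔ x + u p ϖ ε (h.negIndex k) ∈ S := by
    intro k x
    rw [Set.mem_vadd_set_iff_neg_vadd_mem, h.u_negIndex, vadd_eq_add, add_comm]
  constructor
  · intro hS k l hkl
    rw [AEDisjoint, measure_eq_zero_iff_ae_notMem]
    filter_upwards [hS] with x hx
    rintro ⟨hk, hl⟩
    rw [hmem] at hk hl
    have := congrArg h.negIndex (hx _ _ hk hl)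
    rw [h.negIndex_negIndex, h.negIndex_negIndex] at this
    exact hkl this
  · intro hS
    rw [TranslatesDisjoint, ae_all_iff]
    intro m
    rw [ae_all_iff]
    intro n
    by_cases hmn : m = n
    · exact Eventually.of_forall fun _ _ _ => hmn
    · have hne : h.negIndex m ≠ h.negIndex n := fun H => hmn (by
        rw [← h.negIndex_negIndex m, H, h.negIndex_negIndex])
      have : μ (_ ∩ _) = 0 := hS hne
      rw [measure_eq_zero_iff_ae_notMem] at this
      filter_upwards [this] with x hx hxm hxn
      refine absurd ?_ hx
      rw [Set.mem_inter_iff, hmem, hmem, h.negIndex_negIndex, h.negIndex_negIndex]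
      exact ⟨hxm, hxn⟩

theorem tsum_enorm_inner_gaborLp (f : Lp ℂ 2 μ) :
    ∑' i, ‖inner ℂ (h.gaborLp i) f‖ₑ ^ 2 = ‖f‖ₑ ^ 2 := by
  have := hilbertBasis_tsum_enorm_inner_sq (h.gaborBasis (Equiv.refl _)) f
  simpa only [gaborBasis_apply, Equiv.refl_apply] using this

/-- Extended by zero, `f` has nonzero Gabor coefficients only on the tile with index `0`, which is
`𝒪`. -/
theorem tsum_enorm_coeff_of_memLp {f : K → ℂ} (hf : MemLp f 2 (μ.restrict (Metric.closedBall 0 1))) :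
    ∑' k, ‖∫ x in Metric.closedBall 0 1, charFn χ (-(u p ϖ ε k * x)) * f x ∂μ‖ₑ ^ 2 =
      ∫⁻ x in Metric.closedBall 0 1, ‖f x‖ₑ ^ 2 ∂μ := by
  have hm := measurableSet_closedBall' (0 : K) 1
  let F : Lp ℂ 2 μ := ((memLp_indicator_iff_restrict hm).2 hf).toLp
  have hF : F =ᵐ[μ] (Metric.closedBall 0 1).indicator f := MemLp.coeFn_toLp _
  have h1 : ∀ k, inner ℂ (h.gaborLp (0, k)) F =
      ∫ x in Metric.closedBall 0 1, charFn χ (-(u p ϖ ε k * x)) * f x ∂μ := by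
    intro k
    rw [h.inner_gaborLp, h.u_zero]
    refine setIntegral_congr_ae hm (hF.mono fun x hx hx1 => ?_)
    rw [hx, Set.indicator_of_mem hx1]
  have h2 : ∀ m ≠ 0, ∀ k, inner ℂ (h.gaborLp (m, k)) F = 0 := by
    intro m hm0 k
    rw [h.inner_gaborLp, setIntegral_congr_ae (g := fun _ => 0) (measurableSet_closedBall' _ _)]
    · simp
    · filter_upwards [hF] with x hx hxm
      have := Set.disjoint_left.1 (h.pairwise_disjoint_tile hm0) hxm
      beta_reduce at this
      rw [h.u_zero] at this
      rw [hx, Set.indicator_of_notMem this, mul_zero]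
  have h3 := h.tsum_enorm_inner_gaborLp F
  rw [ENNReal.tsum_prod (f := fun m k => ‖inner ℂ (h.gaborLp (m, k)) F‖ₑ ^ 2),
    tsum_eq_single 0 (fun m hm0 => by simp [h2 m hm0])] at h3
  simp_rw [h1] at h3
  rw [h3, enorm_sq_eq_lintegral, ← lintegral_indicator hm]
  refine lintegral_congr_ae (hF.mono fun x hx => ?_)
  simp only
  rw [hx]
  by_cases hx1 : x ∈ Metric.closedBall (0 : K) 1
  · simp only [Set.indicator_of_mem hx1]
  · simp [Set.indicator_of_notMem hx1]

/-- Riesz–Fischer: the square summable coefficients are those of some `G ∈ L²`, and completeness for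
integrable functions gives `f = G` on `𝒪`. Periodizations are only known to be integrable, so this
case is needed. -/
theorem memLp_of_tsum_enorm_coeff {f : K → ℂ} (hf : IntegrableOn f (Metric.closedBall 0 1) μ)
    (hsum : ∑' k, ‖∫ x in Metric.closedBall 0 1, charFn χ (-(u p ϖ ε k * x)) * f x ∂μ‖ₑ ^ 2 ≠ ∞) :
    MemLp f 2 (μ.restrict (Metric.closedBall 0 1)) := by
  classical
  set a : ℕ → ℂ := fun k => ∫ x in Metric.closedBall 0 1, charFn χ (-(u p ϖ ε k * x)) * f x ∂μ
    with ha
  let A : ℕ × ℕ → ℂ := fun i => if i.1 = 0 then a i.2 else 0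
  have hA : Memℓp A 2 := by
    refine memℓp_gen ?_
    have h1 : ∑' i, ‖A i‖ₑ ^ 2 ≠ ∞ := by
      rw [ENNReal.tsum_prod (f := fun m k => ‖A (m, k)‖ₑ ^ 2),
        tsum_eq_single 0 (fun m hm0 => by simp [A, hm0])]
      simpa [A] using hsum
    have h2 : (fun i => ‖A i‖ₑ ^ 2) = fun i => ((‖A i‖₊ ^ 2 : NNReal) : ℝ≥0∞) := by
      ext i; simp [enorm_eq_nnnorm]
    rw [h2, ENNReal.tsum_coe_ne_top_iff_summable, ← NNReal.summable_coe] at h1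
    simpa using h1
  let G : Lp ℂ 2 μ := (h.gaborBasis (Equiv.refl _)).repr.symm ⟨A, hA⟩
  have hG : ∀ k, ∫ x in Metric.closedBall 0 1, charFn χ (-(u p ϖ ε k * x)) * G x ∂μ = a k := by
    intro k
    have h1 := (h.gaborBasis (Equiv.refl _)).repr_apply_apply G (0, k)
    rw [gaborBasis_apply, Equiv.refl_apply, h.inner_gaborLp, LinearIsometryEquiv.apply_symm_apply,
      h.u_zero] at h1
    exact h1.symm
  have hGi : IntegrableOn G (Metric.closedBall 0 1) μ := integrableOn_closedBall (Lp.memLp G) _ _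
  have hint : ∀ {g : K → ℂ}, IntegrableOn g (Metric.closedBall 0 1) μ → ∀ y,
      IntegrableOn (fun x => charFn χ (y * x) * g x) (Metric.closedBall 0 1) μ := fun hg y =>
    hg.bdd_mul (c := 1) (h.continuous_char _).aestronglyMeasurable
      (Eventually.of_forall fun x => by simp)
  have hzero : (fun x => f x - G x) =ᵐ[μ.restrict (Metric.closedBall 0 1)] 0 := by
    refine h.ae_eq_zero_of_coeff_eq_zero (hf.sub hGi) fun k => ?_
    simp_rw [mul_sub]
    rw [integral_sub (hint hf _) (hint hGi _)]
    have hk : u p ϖ ε k = -u p ϖ ε (h.negIndex k) := by rw [h.u_negIndex, neg_neg]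
    simp_rw [hk, neg_mul]
    rw [hG, ha, sub_self]
  refine (memLp_congr_ae (hzero.mono fun x hx => ?_)).2 ((Lp.memLp G).restrict _)
  exact sub_eq_zero.1 hx

/-- Parseval's identity on the ring of integers for integrable functions, as an identity in
`[0, ∞]`. -/
theorem tsum_enorm_coeff {f : K → ℂ} (hf : IntegrableOn f (Metric.closedBall 0 1) μ) :
    ∑' k, ‖∫ x in Metric.closedBall 0 1, charFn χ (-(u p ϖ ε k * x)) * f x ∂μ‖ₑ ^ 2 =
      ∫⁻ x in Metric.closedBall 0 1, ‖f x‖ₑ ^ 2 ∂μ := by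
  by_cases hf2 : MemLp f 2 (μ.restrict (Metric.closedBall 0 1))
  · exact h.tsum_enorm_coeff_of_memLp hf2
  · have h1 : ∫⁻ x in Metric.closedBall 0 1, ‖f x‖ₑ ^ 2 ∂μ = ∞ := by
      by_contra hne
      refine hf2 ⟨hf.1, ?_⟩
      rw [← eLpNorm_two_sq] at hne
      exact lt_top_iff_ne_top.2 fun H => hne (by rw [H]; rfl)
    rw [h1]
    by_contra hne
    exact hf2 (h.memLp_of_tsum_enorm_coeff hf hne)

omit h in
/-- The periodization of `f` with respect to the translations by the `u(n)`. -/
noncomputable def periodization (p : ℕ) {c : ℕ} (ϖ : Kˣ) (ε : Fin c → K) (f : K → ℂ) (x : K) : ℂ :=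
  ∑' n, f (x + u p ϖ ε n)

theorem tsum_lintegral_translate_ne_top {f : K → ℂ} (hf : Integrable f μ) :
    ∑' n, ∫⁻ x in Metric.closedBall 0 1, ‖f (x + u p ϖ ε n)‖ₑ ∂μ ≠ ∞ := by
  rw [← h.lintegral_eq_tsum fun x => ‖f x‖ₑ]
  exact hf.2.ne

theorem aestronglyMeasurable_translate {f : K → ℂ} (hf : Integrable f μ) (a : K) :
    AEStronglyMeasurable (fun x => f (x + a)) (μ.restrict (Metric.closedBall 0 1)) :=
  (hf.comp_add_right a).1.restrict

theorem integrableOn_periodization {f : K → ℂ} (hf : Integrable f μ) :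
    IntegrableOn (periodization p ϖ ε f) (Metric.closedBall 0 1) μ := by
  refine ⟨AEStronglyMeasurable.tsum fun n => h.aestronglyMeasurable_translate hf _, ?_⟩
  calc ∫⁻ x in Metric.closedBall 0 1, ‖periodization p ϖ ε f x‖ₑ ∂μ
      ≤ ∫⁻ x in Metric.closedBall 0 1, ∑' n, ‖f (x + u p ϖ ε n)‖ₑ ∂μ :=
        lintegral_mono fun x => enorm_tsum_le_tsum_enorm
    _ = ∑' n, ∫⁻ x in Metric.closedBall 0 1, ‖f (x + u p ϖ ε n)‖ₑ ∂μ :=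
        lintegral_tsum fun n => (h.aestronglyMeasurable_translate hf _).enorm
    _ < ∞ := (h.tsum_lintegral_translate_ne_top hf).lt_top

theorem integrable_char_mul {f : K → ℂ} (hf : Integrable f μ) (y : K) :
    Integrable (fun x => charFn χ (-(y * x)) * f x) μ := by
  simp_rw [← neg_mul]
  exact hf.bdd_mul (c := 1) (h.continuous_char _).aestronglyMeasurable
      (Eventually.of_forall fun x => by simp)

/-- By self-duality the character `χ(-u(k)·)` is invariant under all translations by `u(n)`, so it
factors out of the periodization. -/
theorem integral_char_mul_periodization {f : K → ℂ} (hf : Integrable f μ) (k : ℕ) :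
    ∫ x in Metric.closedBall 0 1, charFn χ (-(u p ϖ ε k * x)) * periodization p ϖ ε f x ∂μ =
      ∫ x, charFn χ (-(u p ϖ ε k * x)) * f x ∂μ := by
  have hg := h.integrable_char_mul hf (u p ϖ ε k)
  rw [← (h.hasSum_integral hg).tsum_eq, ← integral_tsum
    (fun n => h.aestronglyMeasurable_translate hg _) (h.tsum_lintegral_translate_ne_top hg)]
  refine integral_congr_ae (Eventually.of_forall fun x => ?_)
  simp only [periodization]
  rw [← tsum_mul_left]
  refine tsum_congr fun n => ?_
  rw [mul_add, neg_add, charFn_add, charFn_neg (u p ϖ ε k * u p ϖ ε n), h.charFn_eq_one_of_u,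
    map_one, mul_one]

theorem tsum_enorm_integral_char_mul {f : K → ℂ} (hf : Integrable f μ) :
    ∑' k, ‖∫ x, charFn χ (u p ϖ ε k * x) * f x ∂μ‖ₑ ^ 2 =
      ∫⁻ x in Metric.closedBall 0 1, ‖periodization p ϖ ε f x‖ₑ ^ 2 ∂μ := by
  rw [← h.tsum_enorm_coeff (h.integrableOn_periodization hf)]
  let σ : ℕ ≃ ℕ := ⟨h.negIndex, h.negIndex, h.negIndex_negIndex, h.negIndex_negIndex⟩
  rw [← σ.tsum_eq]
  refine tsum_congr fun k => ?_
  rw [h.integral_char_mul_periodization hf]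
  have : ∀ x, u p ϖ ε (σ k) * x = -(u p ϖ ε k * x) := fun x => by
    rw [← neg_mul, ← h.u_negIndex]; rfl
  simp_rw [this]

/-- Inserting the indicator changes nothing almost everywhere, but makes the function to be
periodized vanish at every point off `S`. The pointwise arguments on orbits below rely on this. -/
theorem inner_modulation {g : Lp ℂ 2 μ} {S : Set K}
    (hg : (fun ξ => ‖g ξ‖) =ᵐ[μ] S.indicator (fun _ => (1 : ℝ))) (y : K) (f : Lp ℂ 2 μ) :
    inner ℂ (h.modulation y g) f =
      ∫ ξ, charFn χ (y * ξ) * S.indicator (fun ξ => starRingEnd ℂ (g ξ) * f ξ) ξ ∂μ := by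
  rw [L2.inner_def]
  refine integral_congr_ae ?_
  filter_upwards [h.coeFn_modulation y g, hg] with ξ h1 h2
  rw [h1, RCLike.inner_apply, charFn_neg, map_mul, Complex.conj_conj]
  by_cases hξ : ξ ∈ S
  · rw [Set.indicator_of_mem hξ]; ring
  · rw [Set.indicator_of_notMem hξ, norm_eq_zero] at h2
    rw [Set.indicator_of_notMem hξ, h2]; simp

theorem integrable_indicator_mul {S : Set K} (hS : MeasurableSet S) (g f : Lp ℂ 2 μ) :
    Integrable (S.indicator fun ξ => starRingEnd ℂ (g ξ) * f ξ) μ := by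
  refine Integrable.indicator ?_ hS
  refine (L2.integrable_inner (𝕜 := ℂ) g f).congr (Eventually.of_forall fun x => ?_)
  beta_reduce
  rw [RCLike.inner_apply, mul_comm]

/-- If `|g| = 1_S` and the translates of `S` are disjoint, the modulations of `g` form a Parseval
frame for the functions supported on `S`. -/
theorem tsum_enorm_inner_modulation {g : Lp ℂ 2 μ} {S : Set K} (hS : MeasurableSet S)
    (hg : (fun ξ => ‖g ξ‖) =ᵐ[μ] S.indicator (fun _ => (1 : ℝ)))
    (hdisj : TranslatesDisjoint p ϖ ε μ S) (f : Lp ℂ 2 μ) :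
    ∑' k, ‖inner ℂ (h.modulation (u p ϖ ε k) g) f‖ₑ ^ 2 = ∫⁻ ξ in S, ‖f ξ‖ₑ ^ 2 ∂μ := by
  simp_rw [h.inner_modulation hg]
  set F := S.indicator fun ξ => starRingEnd ℂ (g ξ) * f ξ with hF
  have hFi : Integrable F μ := h.integrable_indicator_mul hS g f
  have h1 : ∫⁻ ξ in S, ‖f ξ‖ₑ ^ 2 ∂μ = ∫⁻ ξ, ‖F ξ‖ₑ ^ 2 ∂μ := by
    rw [← lintegral_indicator hS]
    refine lintegral_congr_ae ?_
    filter_upwards [hg] with ξ h2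
    by_cases hξ : ξ ∈ S
    · rw [Set.indicator_of_mem hξ] at h2
      have h3 : ‖g ξ‖ₑ = 1 := by rw [← ofReal_norm, h2, ENNReal.ofReal_one]
      rw [hF, Set.indicator_of_mem hξ, Set.indicator_of_mem hξ, enorm_mul, RCLike.enorm_conj, h3,
        one_mul]
    · rw [hF, Set.indicator_of_notMem hξ, Set.indicator_of_notMem hξ]; simp
  rw [h.tsum_enorm_integral_char_mul hFi, h1, h.lintegral_eq_tsum fun x => ‖F x‖ₑ ^ 2, ← lintegral_tsum
    fun n => (h.aestronglyMeasurable_translate hFi _).enorm.pow_const 2]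
  refine lintegral_congr_ae (ae_restrict_of_ae (hdisj.mono fun x hx => ?_))
  simp only [periodization]
  have hoff : ∀ n, x + u p ϖ ε n ∉ S → F (x + u p ϖ ε n) = 0 := fun n hn =>
    Set.indicator_of_notMem hn _
  -- At most one term of the periodization is nonzero, so the square of the sum is the sum of the
  -- squares.
  by_cases hex : ∃ n, x + u p ϖ ε n ∈ S
  · obtain ⟨n, hn⟩ := hex
    have hm : ∀ m, m ≠ n → F (x + u p ϖ ε m) = 0 := fun m hmn =>
      hoff m fun H => hmn (hx m n H hn)
    rw [tsum_eq_single n hm, tsum_eq_single n fun m hmn => by simp [hm m hmn]]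
  · push Not at hex
    simp [hoff _ (hex _)]

theorem ae_of_ae_integers {P : K → Prop}
    (hP : ∀ᵐ x ∂(μ.restrict (Metric.closedBall 0 1)), P x)
    (hinv : ∀ x k, P (x - u p ϖ ε k) → P x) : ∀ᵐ x ∂μ, P x := by
  rw [ae_restrict_iff' (measurableSet_closedBall' _ _)] at hP
  have h1 : ∀ᵐ x ∂μ, ∀ k, x - u p ϖ ε k ∈ Metric.closedBall (0 : K) 1 → P (x - u p ϖ ε k) :=
    ae_all_iff.2 fun k => (measurePreserving_sub_right μ _).quasiMeasurePreserving.ae hP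
  filter_upwards [h1] with x hx
  obtain ⟨k, hk⟩ := h.exists_norm_sub_u_le x
  exact hinv x k (hx k (by simpa using hk))

/-- If `|g| = 1_S` and the modulations of `g` satisfy Bessel's inequality for `g` itself, then the
translates of `S` are disjoint. -/
theorem translatesDisjoint_of_tsum_le {g : Lp ℂ 2 μ} {S : Set K} (hS : MeasurableSet S)
    (hg : (fun ξ => ‖g ξ‖) =ᵐ[μ] S.indicator (fun _ => (1 : ℝ)))
    (hle : ∑' k, ‖inner ℂ (h.modulation (u p ϖ ε k) g) g‖ₑ ^ 2 ≤ ‖g‖ₑ ^ 2) :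
    TranslatesDisjoint p ϖ ε μ S := by
  set F : K → ℂ := S.indicator fun _ => 1 with hF
  have hFg : S.indicator (fun ξ => starRingEnd ℂ (g ξ) * g ξ) =ᵐ[μ] F := by
    filter_upwards [hg] with ξ h2
    by_cases hξ : ξ ∈ S
    · rw [Set.indicator_of_mem hξ] at h2
      rw [hF, Set.indicator_of_mem hξ, Set.indicator_of_mem hξ, RCLike.conj_mul, h2]; simp
    · rw [hF, Set.indicator_of_notMem hξ, Set.indicator_of_notMem hξ]
  have hFi : Integrable F μ := (h.integrable_indicator_mul hS g g).congr hFg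
  have hinner : ∀ k, inner ℂ (h.modulation (u p ϖ ε k) g) g =
      ∫ x, charFn χ (u p ϖ ε k * x) * F x ∂μ := fun k => by
    rw [h.inner_modulation hg]
    exact integral_congr_ae (hFg.mono fun x hx => by simp only [hx])
  simp_rw [hinner] at hle
  rw [h.tsum_enorm_integral_char_mul hFi] at hle
  -- `N` counts the `n` with `x + u(n) ∈ S`. Its integral over `𝒪` is `‖g‖²`, and Bessel's
  -- inequality bounds the integral of `N²` by the same number. A count satisfies `N ≤ N²`, so
  -- equality holds a.e. and `N` is `0` or `1`.
  let N : K → ℝ≥0∞ := fun x => ∑' n, ‖F (x + u p ϖ ε n)‖ₑ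
  have hNm : AEMeasurable N (μ.restrict (Metric.closedBall 0 1)) :=
    AEMeasurable.tsum fun n => (h.aestronglyMeasurable_translate hFi _).enorm
  have hNint : ∫⁻ x in Metric.closedBall 0 1, N x ∂μ = ‖g‖ₑ ^ 2 := by
    rw [lintegral_tsum fun n => (h.aestronglyMeasurable_translate hFi _).enorm,
      ← h.lintegral_eq_tsum fun x => ‖F x‖ₑ, enorm_sq_eq_lintegral]
    refine lintegral_congr_ae ?_
    filter_upwards [hg] with ξ h2
    rw [← ofReal_norm (g ξ), h2]
    by_cases hξ : ξ ∈ S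
    · simp [hF, hξ]
    · simp [hF, hξ]
  have hNtop : ∫⁻ x in Metric.closedBall 0 1, N x ∂μ ≠ ∞ := by
    rw [hNint, enorm_eq_nnnorm]; exact ENNReal.pow_ne_top ENNReal.coe_ne_top
  have hNfin : ∀ᵐ x ∂(μ.restrict (Metric.closedBall 0 1)), N x < ∞ := ae_lt_top' hNm hNtop
  have hPN : ∀ x, N x < ∞ → ‖periodization p ϖ ε F x‖ₑ = N x := by
    intro x hx
    have hFr : ∀ y, F y = ((S.indicator (fun _ => (1 : ℝ)) y : ℝ) : ℂ) := fun y => by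
      by_cases hy : y ∈ S
      · simp [hF, hy]
      · simp [hF, hy]
    have hnn : ∀ y, 0 ≤ S.indicator (fun _ => (1 : ℝ)) y :=
      Set.indicator_nonneg fun _ _ => zero_le_one
    have hsum : Summable fun n => S.indicator (fun _ => (1 : ℝ)) (x + u p ϖ ε n) := by
      have := tsum_enorm_ne_top_iff_summable_norm.1 hx.ne
      refine this.congr fun n => ?_
      rw [hFr, Complex.norm_real, Real.norm_of_nonneg (hnn _)]
    have hN : N x = ∑' n, ENNReal.ofReal (S.indicator (fun _ => (1 : ℝ)) (x + u p ϖ ε n)) :=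
      tsum_congr fun n => by
        rw [← ofReal_norm, hFr, Complex.norm_real, Real.norm_of_nonneg (hnn _)]
    rw [hN, ← ENNReal.ofReal_tsum_of_nonneg (fun n => hnn _) hsum, periodization]
    simp_rw [hFr]
    rw [← Complex.ofReal_tsum, ← ofReal_norm, Complex.norm_real,
      Real.norm_of_nonneg (tsum_nonneg fun n => hnn _)]
  have hFone : ∀ y ∈ S, ‖F y‖ₑ = 1 := fun y hy => by simp [hF, hy]
  have hNsq : ∀ x, N x ≤ N x ^ 2 := by
    intro x
    by_cases hex : ∃ n, x + u p ϖ ε n ∈ S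
    · obtain ⟨n, hn⟩ := hex
      have : 1 ≤ N x := by
        rw [← hFone _ hn]
        exact ENNReal.le_tsum (f := fun n => ‖F (x + u p ϖ ε n)‖ₑ) n
      rw [sq]
      exact le_mul_of_one_le_right' this
    · push Not at hex
      have : N x = 0 := ENNReal.tsum_eq_zero.2 fun n => by simp [hF, hex n]
      rw [this]; exact zero_le
  have heq : N =ᵐ[μ.restrict (Metric.closedBall 0 1)] fun x => N x ^ 2 := by
    refine ae_eq_of_ae_le_of_lintegral_le (Eventually.of_forall hNsq) hNtop (hNm.pow_const 2) ?_
    rw [hNint, lintegral_congr_ae (hNfin.mono fun x hx => by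
      show N x ^ 2 = ‖periodization p ϖ ε F x‖ₑ ^ 2
      rw [hPN x hx])]
    exact hle
  refine h.ae_of_ae_integers ?_ fun x k hx m n hm hn => ?_
  · filter_upwards [heq, hNfin] with x hx hfin m n hm hn
    by_contra hmn
    have h2 : 2 ≤ N x := by
      have := ENNReal.sum_le_tsum (f := fun n => ‖F (x + u p ϖ ε n)‖ₑ) {m, n}
      rw [Finset.sum_pair hmn, hFone _ hm, hFone _ hn, one_add_one_eq_two] at this
      exact this
    have hne : N x ≠ 0 := fun H => by rw [H] at h2; simp at h2
    have h1 : N x = 1 := by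
      have : N x * 1 = N x * N x := by rw [mul_one, ← sq]; exact hx
      exact ((ENNReal.mul_right_inj hne hfin.ne).1 this).symm
    rw [h1] at h2
    exact absurd h2 (by norm_num)
  -- The condition on `x` is invariant under translation by `u(k)`, which merely relabels the
  -- indices by the group law.
  · obtain ⟨m', hm'⟩ := h.exists_u_add m k
    obtain ⟨n', hn'⟩ := h.exists_u_add n k
    have := hx m' n' (by rw [← hm']; convert hm using 1; ring)
      (by rw [← hn']; convert hn using 1; ring)
    rw [this, ← hn'] at hm'
    exact h.u_injective (add_right_cancel hm')

end IsHarmonicSetting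

end Periodization

/-- A vector of `V` orthogonal to the whole family has norm zero by Parseval. So a Parseval frame
determines the closed space it belongs to, which is how core spaces are identified. -/
theorem IsParsevalFrameFor.topologicalClosure_span {H ι : Type*} [NormedAddCommGroup H]
    [InnerProductSpace ℂ H] [CompleteSpace H] {e : ι → H} {V : Submodule ℂ H}
    (he : IsParsevalFrameFor e V) (hV : IsClosed (V : Set H)) :
    (Submodule.span ℂ (Set.range e)).topologicalClosure = V := by
  have hle : (Submodule.span ℂ (Set.range e)).topologicalClosure ≤ V :=
    Submodule.topologicalClosure_minimal _
      (Submodule.span_le.2 (Set.range_subset_iff.2 he.1)) hV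
  refine le_antisymm hle fun f hf => ?_
  have : CompleteSpace (Submodule.span ℂ (Set.range e)).topologicalClosure :=
    (Submodule.isClosed_topologicalClosure _).completeSpace_coe
  obtain ⟨w, hw, z, hz, rfl⟩ :=
    (Submodule.span ℂ (Set.range e)).topologicalClosure.exists_add_mem_mem_orthogonal f
  have hzV : z ∈ V := by simpa using V.sub_mem hf (hle hw)
  have h0 : ∀ i, inner ℂ (e i) z = 0 := fun i =>
    (Submodule.mem_orthogonal _ _).1 hz _
      (Submodule.le_topologicalClosure _ (Submodule.subset_span ⟨i, rfl⟩))
  have h1 := he.2 z hzV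
  simp only [h0, norm_zero, ne_eq, OfNat.ofNat_ne_zero, not_false_eq_true, zero_pow] at h1
  have h2 : z = 0 := by simpa using h1.unique hasSum_zero
  rwa [h2, add_zero]

/-! ### Subspaces of functions supported on a set. -/

section SupportedOn

variable {X : Type*} [MeasurableSpace X] {μ : Measure X}

/-- The functions in `L²` vanishing almost everywhere outside `S`. -/
def supportedOn (μ : Measure X) (S : Set X) : Submodule ℂ (Lp ℂ 2 μ) where
  carrier := {f | ∀ᵐ x ∂μ, x ∉ S → f x = 0}
  add_mem' {f g} hf hg := by
    filter_upwards [hf, hg, Lp.coeFn_add f g] with x h1 h2 h3 hx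
    rw [h3, Pi.add_apply, h1 hx, h2 hx, add_zero]
  zero_mem' := by
    filter_upwards [Lp.coeFn_zero ℂ 2 μ] with x h1 _
    rw [h1, Pi.zero_apply]
  smul_mem' z f hf := by
    filter_upwards [hf, Lp.coeFn_smul z f] with x h1 h2 hx
    rw [h2, Pi.smul_apply, h1 hx, smul_zero]

theorem mem_supportedOn {S : Set X} {f : Lp ℂ 2 μ} :
    f ∈ supportedOn μ S ↔ ∀ᵐ x ∂μ, x ∉ S → f x = 0 := Iff.rfl

theorem isClosed_supportedOn (S : Set X) : IsClosed (supportedOn μ S : Set (Lp ℂ 2 μ)) := by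
  refine IsSeqClosed.isClosed fun f g hf hfg => ?_
  obtain ⟨s, -, hs⟩ := (tendstoInMeasure_of_tendsto_Lp hfg).exists_seq_tendsto_ae'
  have h1 : ∀ᵐ x ∂μ, ∀ n, x ∉ S → f n x = 0 := ae_all_iff.2 hf
  refine mem_supportedOn.2 ?_
  filter_upwards [hs, h1] with x h2 h3 hx
  refine tendsto_nhds_unique h2 ?_
  simp [h3 _ hx]

theorem supportedOn_mono {S T : Set X} (hST : S ≤ᵐ[μ] T) : supportedOn μ S ≤ supportedOn μ T := by
  intro f hf
  rw [mem_supportedOn] at hf ⊢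
  filter_upwards [hf, hST] with x h1 h2 hx
  exact h1 fun H => hx (h2 H)

/-- Indicators of the finite-measure pieces of `S` serve as test functions. -/
theorem ae_le_of_supportedOn_le [SigmaFinite μ] {S T : Set X} (hS : MeasurableSet S)
    (hST : supportedOn μ S ≤ supportedOn μ T) : S ≤ᵐ[μ] T := by
  have h1 : ∀ n, ∀ᵐ x ∂μ, x ∈ S ∩ spanningSets μ n → x ∈ T := by
    intro n
    have hm : MeasurableSet (S ∩ spanningSets μ n) := hS.inter (measurableSet_spanningSets μ n)
    have hfin : μ (S ∩ spanningSets μ n) ≠ ∞ :=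
      ((measure_mono Set.inter_subset_right).trans_lt (measure_spanningSets_lt_top μ n)).ne
    have hae : indicatorConstLp 2 hm hfin (1 : ℂ) =ᵐ[μ] _ := indicatorConstLp_coeFn
    have h2 : indicatorConstLp 2 hm hfin (1 : ℂ) ∈ supportedOn μ S := by
      refine mem_supportedOn.2 (hae.mono fun x hx hxS => ?_)
      rw [hx, Set.indicator_of_notMem fun H => hxS H.1]
    filter_upwards [mem_supportedOn.1 (hST h2), hae] with x h3 h4 hx
    by_contra hxT
    rw [h4, Set.indicator_of_mem hx] at h3
    exact one_ne_zero (h3 hxT)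
  filter_upwards [ae_all_iff.2 h1] with x hx hxS
  exact hx (spanningSetsIndex μ x) ⟨hxS, mem_spanningSetsIndex μ x⟩

end SupportedOn

/-! ### Spaces of functions with spectrum in `S`, and the criterion for scaling functions. -/

section Subspaces

variable {K : Type*} [NontriviallyNormedField K] [IsUltrametricDist K] [LocallyCompactSpace K]
  [MeasurableSpace K] [BorelSpace K] {p c : ℕ} {ϖ : Kˣ} {ε : Fin c → K}
  {χ : AddChar K Circle} {μ : Measure K} [μ.IsAddHaarMeasure]

theorem mem_zpow_neg_smul_set {S : Set K} {j : ℤ} {x : K} : x ∈ ϖ ^ (-j) • S ↔ ϖ ^ j • x ∈ S := by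
  rw [Set.mem_smul_set_iff_inv_smul_mem, zpow_neg, inv_inv]

theorem ae_forall_zpow_smul {P : K → Prop} (hP : ∀ᵐ x ∂μ, P x) :
    ∀ᵐ x ∂μ, ∀ j : ℤ, P (ϖ ^ j • x) :=
  ae_all_iff.2 fun j => ae_comp_smul hP (ϖ ^ j)

namespace IsHarmonicSetting

variable (h : IsHarmonicSetting p ϖ ε χ μ)
include h

/-- The functions in `L²(K)` whose Fourier transform is supported on `S`. -/
noncomputable def bandlimited (S : Set K) : Submodule ℂ (Lp ℂ 2 μ) :=
  (supportedOn μ S).comap (h.fourierL2.toLinearEquiv : Lp ℂ 2 μ →ₗ[ℂ] Lp ℂ 2 μ)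

theorem mem_bandlimited {S : Set K} {f : Lp ℂ 2 μ} :
    f ∈ h.bandlimited S ↔ ∀ᵐ ξ ∂μ, ξ ∉ S → h.fourierL2 f ξ = 0 := Iff.rfl

theorem isClosed_bandlimited (S : Set K) : IsClosed (h.bandlimited S : Set (Lp ℂ 2 μ)) :=
  (isClosed_supportedOn S).preimage h.fourierL2.continuous

theorem bandlimited_mono {S T : Set K} (hST : S ≤ᵐ[μ] T) : h.bandlimited S ≤ h.bandlimited T :=
  Submodule.comap_mono (supportedOn_mono hST)

theorem ae_le_of_bandlimited_le {S T : Set K} (hS : MeasurableSet S)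
    (hST : h.bandlimited S ≤ h.bandlimited T) : S ≤ᵐ[μ] T := by
  refine ae_le_of_supportedOn_le hS fun f hf => ?_
  have h1 : h.fourierL2.symm f ∈ h.bandlimited S := by
    rw [h.mem_bandlimited, LinearIsometryEquiv.apply_symm_apply]; exact hf
  have h2 := (h.mem_bandlimited).1 (hST h1)
  rwa [LinearIsometryEquiv.apply_symm_apply] at h2

theorem mem_map_dilation {V : Submodule ℂ (Lp ℂ 2 μ)} {j : ℤ} {f : Lp ℂ 2 μ} :
    f ∈ V.map (dilation μ (p ^ c) ϖ j) ↔ dilation μ (p ^ c) ϖ (-j) f ∈ V := by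
  constructor
  · rintro ⟨g, hg, rfl⟩
    rwa [dilation_dilation h.q_pos, neg_add_cancel, dilation_zero]
  · exact fun hf => ⟨_, hf, by rw [dilation_dilation h.q_pos, add_neg_cancel, dilation_zero]⟩

theorem q_rpow_ne_zero (t : ℝ) : (((((p ^ c : ℕ) : ℝ) ^ t : ℝ)) : ℂ) ≠ 0 := by
  have : (0 : ℝ) < ((p ^ c : ℕ) : ℝ) := by exact_mod_cast h.q_pos
  exact Complex.ofReal_ne_zero.2 (Real.rpow_pos_of_pos this t).ne'

theorem map_dilation_bandlimited (S : Set K) (j : ℤ) :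
    (h.bandlimited S).map (dilation μ (p ^ c) ϖ j) = h.bandlimited (ϖ ^ (-j) • S) := by
  ext f
  rw [h.mem_map_dilation, h.mem_bandlimited, h.mem_bandlimited, h.fourierL2_dilation, neg_neg]
  have hd := coeFn_dilation (p ^ c) j (h.fourierL2 f) (ϖ := ϖ)
  constructor
  · intro hf
    have h1 : ∀ᵐ x ∂μ, x ∉ S → h.fourierL2 f (ϖ ^ (-j) • x) = 0 := by
      filter_upwards [hf, hd] with x h2 h3 hx
      rw [h3] at h2
      exact (mul_eq_zero.1 (h2 hx)).resolve_left (h.q_rpow_ne_zero _)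
    filter_upwards [ae_comp_smul h1 (ϖ ^ j)] with x h2 hx
    rw [mem_zpow_neg_smul_set] at hx
    have := h2 hx
    rwa [smul_smul, ← zpow_add, neg_add_cancel, zpow_zero, one_smul] at this
  · intro hf
    filter_upwards [ae_comp_smul hf (ϖ ^ (-j)), hd] with x h2 h3 hx
    rw [h3, h2, mul_zero]
    rwa [mem_zpow_neg_smul_set, smul_smul, ← zpow_add, add_neg_cancel, zpow_zero, one_smul]

theorem translation_mem_bandlimited {S : Set K} (y : K) {f : Lp ℂ 2 μ} (hf : f ∈ h.bandlimited S) :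
    translation μ y f ∈ h.bandlimited S := by
  rw [h.mem_bandlimited] at hf ⊢
  rw [h.fourierL2_translation]
  filter_upwards [hf, h.coeFn_modulation y (h.fourierL2 f)] with ξ h1 h2 hξ
  rw [h2, h1 hξ, mul_zero]

theorem map_T_bandlimited (S : Set K) (k : ℕ) :
    (h.bandlimited S).map (T μ p ϖ ε k) = h.bandlimited S := by
  refine le_antisymm ?_ fun f hf => ?_
  · rintro _ ⟨f, hf, rfl⟩
    exact h.translation_mem_bandlimited _ hf
  · refine ⟨translation μ (-u p ϖ ε k) f, h.translation_mem_bandlimited _ hf, Lp.ext ?_⟩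
    have h1 := (measurePreserving_sub_right μ (u p ϖ ε k)).quasiMeasurePreserving.ae
      (coeFn_translation (-u p ϖ ε k) f)
    filter_upwards [coeFn_translation (u p ϖ ε k) (translation μ (-u p ϖ ε k) f), h1]
      with x h2 h3
    refine h2.trans (h3.trans ?_)
    simp

theorem inner_T (φ f : Lp ℂ 2 μ) (k : ℕ) : inner ℂ (T μ p ϖ ε k φ) f =
    inner ℂ (h.modulation (u p ϖ ε k) (h.fourierL2 φ)) (h.fourierL2 f) := by
  rw [← h.fourierL2_translation, LinearIsometryEquiv.inner_map_map]; rfl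

theorem inner_dilation (j : ℤ) (g f : Lp ℂ 2 μ) : inner ℂ (dilation μ (p ^ c) ϖ j g) f =
    inner ℂ g (dilation μ (p ^ c) ϖ (-j) f) := by
  have h1 := (h.dilationIsometry j).inner_map_map g (dilation μ (p ^ c) ϖ (-j) f)
  change inner ℂ (dilation μ (p ^ c) ϖ j g)
    (dilation μ (p ^ c) ϖ j (dilation μ (p ^ c) ϖ (-j) f)) = _ at h1
  rwa [dilation_dilation h.q_pos, add_neg_cancel, dilation_zero] at h1

theorem mem_bandlimited_of_norm_eq {φ : Lp ℂ 2 μ} {S : Set K}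
    (hφ : (fun ξ => ‖h.fourierL2 φ ξ‖) =ᵐ[μ] S.indicator (fun _ => (1 : ℝ))) :
    φ ∈ h.bandlimited S := by
  rw [h.mem_bandlimited]
  filter_upwards [hφ] with ξ hξ hξS
  rwa [Set.indicator_of_notMem hξS, norm_eq_zero] at hξ

theorem isParsevalFrameFor_bandlimited {φ : Lp ℂ 2 μ} {S : Set K} (hS : MeasurableSet S)
    (hφ : (fun ξ => ‖h.fourierL2 φ ξ‖) =ᵐ[μ] S.indicator (fun _ => (1 : ℝ)))
    (hdisj : TranslatesDisjoint p ϖ ε μ S) :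
    IsParsevalFrameFor (fun k => T μ p ϖ ε k φ) (h.bandlimited S) := by
  refine ⟨fun k => h.translation_mem_bandlimited _ (h.mem_bandlimited_of_norm_eq hφ),
    fun f hf => ?_⟩
  rw [hasSum_sq_norm_iff]
  simp_rw [h.inner_T]
  rw [h.tsum_enorm_inner_modulation hS hφ hdisj, ← h.fourierL2.enorm_map f, enorm_sq_eq_lintegral,
    ← lintegral_indicator hS]
  refine lintegral_congr_ae ?_
  filter_upwards [h.mem_bandlimited.1 hf] with ξ hξ
  by_cases hξS : ξ ∈ S
  · rw [Set.indicator_of_mem hξS]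
  · rw [Set.indicator_of_notMem hξS, hξ hξS]; simp

theorem measure_eq_enorm_sq {g : Lp ℂ 2 μ} {S : Set K} (hS : MeasurableSet S)
    (hg : (fun ξ => ‖g ξ‖) =ᵐ[μ] S.indicator (fun _ => (1 : ℝ))) : μ S = ‖g‖ₑ ^ 2 := by
  rw [enorm_sq_eq_lintegral, ← lintegral_indicator_one hS]
  refine lintegral_congr_ae (hg.mono fun ξ hξ => ?_)
  beta_reduce at hξ ⊢
  rw [← ofReal_norm, hξ]
  by_cases hξS : ξ ∈ S
  · simp [hξS]
  · simp [hξS]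

theorem measure_lt_top {g : Lp ℂ 2 μ} {S : Set K} (hS : MeasurableSet S)
    (hg : (fun ξ => ‖g ξ‖) =ᵐ[μ] S.indicator (fun _ => (1 : ℝ))) : μ S < ∞ := by
  rw [h.measure_eq_enorm_sq hS hg, enorm_eq_nnnorm]
  exact ENNReal.pow_lt_top ENNReal.coe_lt_top

/-- Parseval's identity for `φ` itself gives disjointness. The translates of `φ` are then a Parseval
frame for both closed spaces, and each is the closed span of these translates. -/
theorem bandlimited_of_isPMRA {φ : Lp ℂ 2 μ} {S : Set K} (hS : MeasurableSet S)
    (hφ : (fun ξ => ‖h.fourierL2 φ ξ‖) =ᵐ[μ] S.indicator (fun _ => (1 : ℝ)))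
    {V : Submodule ℂ (Lp ℂ 2 μ)} (hV : IsPMRA μ p ϖ ε V φ) :
    TranslatesDisjoint p ϖ ε μ S ∧ V = h.bandlimited S := by
  have h1 : TranslatesDisjoint p ϖ ε μ S := by
    refine h.translatesDisjoint_of_tsum_le hS hφ (le_of_eq ?_)
    have h2 := hasSum_sq_norm_iff.1 (hV.parseval.2 φ hV.mem)
    simp_rw [h.inner_T] at h2
    rw [h2, LinearIsometryEquiv.enorm_map]
  refine ⟨h1, ?_⟩
  have hclosed : IsClosed (V : Set (Lp ℂ 2 μ)) := by
    have h2 := hV.isClosed 0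
    convert h2 using 1
    ext f
    rw [SetLike.mem_coe, SetLike.mem_coe, h.mem_map_dilation, neg_zero, dilation_zero]
  rw [← hV.parseval.topologicalClosure_span hclosed,
    (h.isParsevalFrameFor_bandlimited hS hφ h1).topologicalClosure_span (h.isClosed_bandlimited S)]

theorem iUnion_ae_eq_univ_of_isPMRA {φ : Lp ℂ 2 μ} {S : Set K}
    (hV : IsPMRA μ p ϖ ε (h.bandlimited S) φ) :
    (⋃ j : ℤ, ϖ ^ (-j) • S) =ᵐ[μ] (Set.univ : Set K) := by
  have h1 := hV.closure_iUnion
  have h2 : closure (⋃ j : ℤ, ((h.bandlimited S).map (dilation μ (p ^ c) ϖ j) : Set (Lp ℂ 2 μ))) ⊆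
      h.bandlimited (⋃ j : ℤ, ϖ ^ (-j) • S) := by
    refine closure_minimal (Set.iUnion_subset fun j => ?_) (h.isClosed_bandlimited _)
    rw [SetLike.coe_subset_coe, h.map_dilation_bandlimited]
    exact h.bandlimited_mono (Set.subset_iUnion (fun j : ℤ => ϖ ^ (-j) • S) j).eventuallyLE
  rw [h1] at h2
  refine EventuallyLE.antisymm (Set.subset_univ _).eventuallyLE ?_
  exact h.ae_le_of_bandlimited_le MeasurableSet.univ fun f _ => h2 (Set.mem_univ f)

theorem ae_le_smul_of_isPMRA {φ : Lp ℂ 2 μ} {S : Set K} (hS : MeasurableSet S)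
    (hV : IsPMRA μ p ϖ ε (h.bandlimited S) φ) : S ≤ᵐ[μ] (ϖ⁻¹ • S : Set K) := by
  have h1 := hV.le_dilation
  rw [h.map_dilation_bandlimited, zpow_neg_one] at h1
  exact h.ae_le_of_bandlimited_le hS h1

/-- This set is invariant under `ϖ`, while its preimage under `ϖ` has `q > 1` times its measure.
Finite measure then forces measure zero. -/
theorem measure_forall_zpow_smul_mem {S : Set K} (hS : MeasurableSet S) (hfin : μ S < ∞) :
    μ {x | ∀ j : ℤ, ϖ ^ j • x ∈ S} = 0 := by
  set Z := {x : K | ∀ j : ℤ, ϖ ^ j • x ∈ S} with hZ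
  have hZm : MeasurableSet Z := by
    rw [hZ, Set.ofPred_forall]
    exact MeasurableSet.iInter fun j => measurable_const_smul (ϖ ^ j) hS
  have hZfin : μ Z < ∞ := (measure_mono fun x hx => by simpa using hx 0).trans_lt hfin
  have hinv : (fun x : K => ϖ ^ (1 : ℤ) • x) ⁻¹' Z = Z := by
    ext x
    simp only [hZ, Set.mem_preimage, Set.mem_ofPred_eq, smul_smul, ← zpow_add]
    exact ⟨fun H j => by simpa using H (j - 1), fun H j => H _⟩
  have h1 := congrArg (fun m : Measure K => m Z) (h.map_smul_measure (μ := μ) 1)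
  beta_reduce at h1
  rw [Measure.map_apply (measurable_const_smul (ϖ ^ (1 : ℤ))) hZm, hinv, zpow_one,
    Measure.smul_apply] at h1
  by_contra hne
  have h2 : (1 : ℝ≥0∞) * μ Z = ((p ^ c : ℕ) : ℝ≥0∞) * μ Z := by
    rw [one_mul]
    refine h1.trans ?_
    rw [ENNReal.smul_def, smul_eq_mul]
    simp
  rw [ENNReal.mul_left_inj hne hZfin.ne] at h2
  have h3 := h.one_lt_q
  have h4 : p ^ c = 1 := by exact_mod_cast h2.symm
  omega

/-- Almost every orbit of the dilation enters `S` and stays there from some index on. -/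
theorem exists_threshold {S : Set K} (hS : MeasurableSet S) (hfin : μ S < ∞)
    (hcover : (⋃ j : ℤ, ϖ ^ (-j) • S) =ᵐ[μ] (Set.univ : Set K))
    (hsub : S ≤ᵐ[μ] (ϖ⁻¹ • S : Set K)) :
    ∀ᵐ x ∂μ, ∃ j₀ : ℤ, ∀ j : ℤ, ϖ ^ j • x ∈ S ↔ j₀ ≤ j := by
  have h1 : ∀ᵐ x ∂μ, ¬ ∀ j : ℤ, ϖ ^ j • x ∈ S :=
    measure_eq_zero_iff_ae_notMem.1 (h.measure_forall_zpow_smul_mem hS hfin)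
  filter_upwards [h1, hcover, ae_forall_zpow_smul (ϖ := ϖ) hsub] with x h2 h3 h4
  have hstep : ∀ j : ℤ, ϖ ^ j • x ∈ S → ϖ ^ (j + 1) • x ∈ S := by
    intro j hj
    have := h4 j hj
    change ϖ ^ j • x ∈ ϖ⁻¹ • S at this
    rwa [Set.mem_inv_smul_set_iff, smul_smul, ← zpow_one_add, add_comm] at this
  have hmono : ∀ i j : ℤ, i ≤ j → ϖ ^ i • x ∈ S → ϖ ^ j • x ∈ S := by
    intro i j hij hi
    induction j, hij using Int.leInduction with
    | base => exact hi
    | succ j _ ih => exact hstep j ih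
  have hne : ∃ j : ℤ, ϖ ^ j • x ∈ S := by
    have : x ∈ ⋃ j : ℤ, ϖ ^ (-j) • S := h3.mpr trivial
    obtain ⟨j, hj⟩ := Set.mem_iUnion.1 this
    exact ⟨j, mem_zpow_neg_smul_set.1 hj⟩
  push Not at h2
  obtain ⟨b, hb⟩ := h2
  have hbdd : ∀ j : ℤ, ϖ ^ j • x ∈ S → b ≤ j := fun j hj =>
    not_lt.1 fun hlt => hb (hmono j b hlt.le hj)
  obtain ⟨j₀, hj₀, hmin⟩ := Int.exists_least_of_bdd ⟨b, hbdd⟩ hne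
  exact ⟨j₀, fun j => ⟨hmin j, fun hj => hmono j₀ j hj hj₀⟩⟩

/-- Nesting is monotonicity in `S`; the intersection and density conditions come from the orbit
thresholds. -/
theorem isPMRA_bandlimited {φ : Lp ℂ 2 μ} {S : Set K} (hS : MeasurableSet S)
    (hφ : (fun ξ => ‖h.fourierL2 φ ξ‖) =ᵐ[μ] S.indicator (fun _ => (1 : ℝ)))
    (hdisj : TranslatesDisjoint p ϖ ε μ S)
    (hcover : (⋃ j : ℤ, ϖ ^ (-j) • S) =ᵐ[μ] (Set.univ : Set K))
    (hsub : S ≤ᵐ[μ] (ϖ⁻¹ • S : Set K)) : IsPMRA μ p ϖ ε (h.bandlimited S) φ := by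
  have hthr := h.exists_threshold hS (h.measure_lt_top hS hφ) hcover hsub
  refine ⟨fun j => ?_, h.map_T_bandlimited S, ?_, ?_, ?_, h.mem_bandlimited_of_norm_eq hφ,
    h.isParsevalFrameFor_bandlimited hS hφ hdisj⟩
  · rw [h.map_dilation_bandlimited]; exact h.isClosed_bandlimited _
  · rw [h.map_dilation_bandlimited, zpow_neg_one]; exact h.bandlimited_mono hsub
  · rw [eq_bot_iff]
    intro f hf
    simp_rw [Submodule.mem_iInf, h.map_dilation_bandlimited, h.mem_bandlimited] at hf
    have h1 : h.fourierL2 f = 0 := by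
      rw [Lp.eq_zero_iff_ae_eq_zero]
      filter_upwards [ae_all_iff.2 hf, hthr] with x h2 h3
      obtain ⟨j₀, hj₀⟩ := h3
      -- One step below the threshold the orbit is outside `S`, so the transform vanishes at `x`.
      refine h2 (j₀ - 1) fun H => ?_
      rw [mem_zpow_neg_smul_set, hj₀] at H
      omega
    rw [Submodule.mem_bot]
    exact (map_eq_zero_iff _ h.fourierL2.injective).1 h1
  · refine Set.eq_univ_of_forall fun f => ?_
    -- Almost every point lies in `ϖ^(-n)S` for all large `n`, so cutting `f̂` to these sets
    -- approximates `f` by elements of the dilated spaces.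
    have hm : ∀ n : ℕ, MeasurableSet (ϖ ^ (-(n : ℤ)) • S) := fun n => hS.const_smul _
    have h1 := tendsto_cut (h.fourierL2 f) hm (by
      filter_upwards [hthr] with x hx
      obtain ⟨j₀, hj₀⟩ := hx
      filter_upwards [eventually_ge_atTop j₀.toNat] with n hn
      rw [mem_zpow_neg_smul_set, hj₀]
      omega)
    have h2 := (h.fourierL2.symm.continuous.tendsto _).comp h1
    rw [LinearIsometryEquiv.symm_apply_apply] at h2
    refine mem_closure_of_tendsto h2 (Eventually.of_forall fun n => ?_)
    refine Set.mem_iUnion.2 ⟨n, ?_⟩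
    rw [h.map_dilation_bandlimited, SetLike.mem_coe, h.mem_bandlimited, Function.comp_apply,
      LinearIsometryEquiv.apply_symm_apply]
    filter_upwards [coeFn_cut (hm n) (h.fourierL2 f)] with x h3 hx
    rw [h3, Set.indicator_of_notMem hx]

end IsHarmonicSetting

end Subspaces

/-! ### Multiwavelets whose Fourier transforms have modulus an indicator. -/

theorem tsum_indicator_eq_one_iff {ι X : Type*} {A : ι → Set X} {x : ι → X} :
    ∑' i, (A i).indicator (1 : X → ℝ≥0∞) (x i) = 1 ↔ ∃! i, x i ∈ A i := by
  classical
  constructor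
  · intro hsum
    have hex : ∃ i, x i ∈ A i := by
      by_contra hne
      push Not at hne
      simp [Set.indicator_of_notMem (hne _)] at hsum
    obtain ⟨i, hi⟩ := hex
    refine ⟨i, hi, fun j hj => ?_⟩
    by_contra hij
    have h1 := ENNReal.sum_le_tsum (f := fun i => (A i).indicator (1 : X → ℝ≥0∞) (x i)) {j, i}
    rw [Finset.sum_pair hij, hsum, Set.indicator_of_mem hi, Set.indicator_of_mem hj, Pi.one_apply,
      Pi.one_apply, one_add_one_eq_two] at h1
    exact absurd h1 (by norm_num)
  · rintro ⟨i, hi, huniq⟩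
    rw [tsum_eq_single i fun j hj => Set.indicator_of_notMem (fun H => hj (huniq j H)) _,
      Set.indicator_of_mem hi, Pi.one_apply]

section Wavelets

variable {K : Type*} [NontriviallyNormedField K] [IsUltrametricDist K] [LocallyCompactSpace K]
  [MeasurableSpace K] [BorelSpace K] {p c : ℕ} {ϖ : Kˣ} {ε : Fin c → K}
  {χ : AddChar K Circle} {μ : Measure K} [μ.IsAddHaarMeasure]

theorem measurable_indicator_zpow_smul {W : Set K} (hW : MeasurableSet W) (j : ℤ) :
    Measurable fun ξ : K => W.indicator (1 : K → ℝ≥0∞) (ϖ ^ j • ξ) :=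
  (measurable_one.indicator hW).comp (measurable_const_smul (ϖ ^ j))

namespace IsHarmonicSetting

variable (h : IsHarmonicSetting p ϖ ε χ μ)
include h

/-- Moving `D^j` to the other factor reduces to scale zero. A change of variables then gives the
energy of `f̂` on `ϖ^(-j)W`. -/
theorem tsum_enorm_inner_dilation_T {ψ : Lp ℂ 2 μ} {W : Set K} (hW : MeasurableSet W)
    (hψ : (fun ξ => ‖h.fourierL2 ψ ξ‖) =ᵐ[μ] W.indicator (fun _ => (1 : ℝ)))
    (hdisj : TranslatesDisjoint p ϖ ε μ W) (j : ℤ) (f : Lp ℂ 2 μ) :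
    ∑' k, ‖inner ℂ (dilation μ (p ^ c) ϖ j (T μ p ϖ ε k ψ)) f‖ₑ ^ 2 =
      ∫⁻ ξ, W.indicator 1 (ϖ ^ j • ξ) * ‖h.fourierL2 f ξ‖ₑ ^ 2 ∂μ := by
  simp_rw [h.inner_dilation, h.inner_T]
  rw [h.tsum_enorm_inner_modulation hW hψ hdisj, h.fourierL2_dilation, neg_neg,
    ← lintegral_indicator hW]
  have hq : (0 : ℝ) < ((p ^ c : ℕ) : ℝ) := by exact_mod_cast h.q_pos
  have h1 : ∀ᵐ ξ ∂μ, W.indicator (fun ξ => ‖dilation μ (p ^ c) ϖ j (h.fourierL2 f) ξ‖ₑ ^ 2) ξ =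
      ((((p ^ c : ℕ) : NNReal) ^ j : NNReal) : ℝ≥0∞) *
        (fun η => W.indicator 1 (ϖ ^ j • η) * ‖h.fourierL2 f η‖ₑ ^ 2) (ϖ ^ (-j) • ξ) := by
    filter_upwards [coeFn_dilation (p ^ c) j (h.fourierL2 f) (ϖ := ϖ)] with ξ hξ
    rw [smul_smul, ← zpow_add, add_neg_cancel, zpow_zero, one_smul]
    by_cases hξW : ξ ∈ W
    · rw [Set.indicator_of_mem hξW, Set.indicator_of_mem hξW, hξ, enorm_mul, mul_pow,
        h.enorm_q_rpow_sq, Pi.one_apply, one_mul]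
    · rw [Set.indicator_of_notMem hξW, Set.indicator_of_notMem hξW, zero_mul, mul_zero]
  rw [lintegral_congr_ae h1, lintegral_const_mul' _ _ ENNReal.coe_ne_top,
    h.lintegral_comp_smul (-j) fun η => W.indicator 1 (ϖ ^ j • η) * ‖h.fourierL2 f η‖ₑ ^ 2,
    ← mul_assoc, ← ENNReal.coe_mul, ← zpow_add₀ (Nat.cast_ne_zero.2 h.q_pos.ne')]
  simp

variable {L : ℕ} {ψ : Fin L → Lp ℂ 2 μ} {W : Fin L → Set K}

theorem tsum_enorm_inner_affineSystem (hW : ∀ m, MeasurableSet (W m))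
    (hψ : ∀ m, (fun ξ => ‖h.fourierL2 (ψ m) ξ‖) =ᵐ[μ] (W m).indicator (fun _ => (1 : ℝ)))
    (hdisj : ∀ m, TranslatesDisjoint p ϖ ε μ (W m)) (f : Lp ℂ 2 μ) :
    ∑' i, ‖inner ℂ (affineSystem μ p ϖ ε ψ i) f‖ₑ ^ 2 =
      ∫⁻ ξ, (∑' i : Fin L × ℤ, (W i.1).indicator 1 (ϖ ^ i.2 • ξ)) *
        ‖h.fourierL2 f ξ‖ₑ ^ 2 ∂μ := by
  rw [ENNReal.tsum_prod (f := fun m jk => ‖inner ℂ (affineSystem μ p ϖ ε ψ (m, jk)) f‖ₑ ^ 2)]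
  have h1 : ∀ m, ∑' jk : ℤ × ℕ, ‖inner ℂ (affineSystem μ p ϖ ε ψ (m, jk)) f‖ₑ ^ 2 =
      ∑' j : ℤ, ∫⁻ ξ, (W m).indicator 1 (ϖ ^ j • ξ) * ‖h.fourierL2 f ξ‖ₑ ^ 2 ∂μ := fun m => by
    rw [ENNReal.tsum_prod (f := fun j k => ‖inner ℂ (affineSystem μ p ϖ ε ψ (m, (j, k))) f‖ₑ ^ 2)]
    exact tsum_congr fun j => h.tsum_enorm_inner_dilation_T (hW m) (hψ m) (hdisj m) j f
  simp_rw [h1]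
  rw [← ENNReal.tsum_prod (f := fun m (j : ℤ) =>
      ∫⁻ ξ, (W m).indicator 1 (ϖ ^ j • ξ) * ‖h.fourierL2 f ξ‖ₑ ^ 2 ∂μ), ← lintegral_tsum]
  · exact lintegral_congr fun ξ => ENNReal.tsum_mul_right
  · exact fun i => ((measurable_indicator_zpow_smul (hW i.1) i.2).aemeasurable).mul
      ((Lp.aestronglyMeasurable _).enorm.pow_const 2)

/-- Calderón's condition for frequency localized multiwavelets. -/
theorem isParsevalMultiwavelet_iff (hW : ∀ m, MeasurableSet (W m))
    (hψ : ∀ m, (fun ξ => ‖h.fourierL2 (ψ m) ξ‖) =ᵐ[μ] (W m).indicator (fun _ => (1 : ℝ)))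
    (hdisj : ∀ m, TranslatesDisjoint p ϖ ε μ (W m)) :
    IsParsevalMultiwavelet μ p ϖ ε ψ ↔
      ∀ᵐ ξ ∂μ, ∃! i : Fin L × ℤ, ϖ ^ i.2 • ξ ∈ W i.1 := by
  have hiff : ∀ ξ : K, (∑' i : Fin L × ℤ, (W i.1).indicator (1 : K → ℝ≥0∞) (ϖ ^ i.2 • ξ)) = 1 ↔
      ∃! i : Fin L × ℤ, ϖ ^ i.2 • ξ ∈ W i.1 := fun ξ =>
    tsum_indicator_eq_one_iff (A := fun i : Fin L × ℤ => W i.1) (x := fun i => ϖ ^ i.2 • ξ)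
  simp_rw [← hiff]
  constructor
  · intro hψ'
    -- Testing the frame identity on `f̂ = 1_E` for all `E` of finite measure determines the sum of
    -- indicators almost everywhere.
    refine ae_eq_of_forall_setLIntegral_eq_of_sigmaFinite (g := fun _ => 1)
      (Measurable.tsum fun i => measurable_indicator_zpow_smul (hW i.1) i.2)
      measurable_const fun E hE hfin => ?_
    have hae : indicatorConstLp 2 hE hfin.ne (1 : ℂ) =ᵐ[μ] _ := indicatorConstLp_coeFn
    have h1 := hasSum_sq_norm_iff.1
      (hψ'.2 (h.fourierL2.symm (indicatorConstLp 2 hE hfin.ne 1)) trivial)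
    rw [h.tsum_enorm_inner_affineSystem hW hψ hdisj, LinearIsometryEquiv.enorm_map,
      enorm_sq_eq_lintegral, LinearIsometryEquiv.apply_symm_apply] at h1
    rw [← lintegral_indicator hE, ← lintegral_indicator hE]
    convert h1 using 1
    · refine lintegral_congr_ae (hae.mono fun ξ hξ => ?_)
      beta_reduce
      rw [hξ]
      by_cases hξE : ξ ∈ E
      · simp [Set.indicator_of_mem hξE]
      · simp [Set.indicator_of_notMem hξE]
    · refine lintegral_congr_ae (hae.mono fun ξ hξ => ?_)
      beta_reduce
      rw [hξ]
      by_cases hξE : ξ ∈ E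
      · simp [Set.indicator_of_mem hξE]
      · simp [Set.indicator_of_notMem hξE]
  · intro hC
    refine ⟨fun _ => trivial, fun f _ => hasSum_sq_norm_iff.2 ?_⟩
    rw [h.tsum_enorm_inner_affineSystem hW hψ hdisj, ← h.fourierL2.enorm_map f,
      enorm_sq_eq_lintegral]
    exact lintegral_congr_ae (hC.mono fun ξ hξ => by beta_reduce; rw [hξ, one_mul])

/-- The scale `j = 0` part of the system for a single `m` is a subfamily of a Parseval frame, so it
satisfies Bessel's inequality. -/
theorem translatesDisjoint_of_isParsevalMultiwavelet (hW : ∀ m, MeasurableSet (W m))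
    (hψ : ∀ m, (fun ξ => ‖h.fourierL2 (ψ m) ξ‖) =ᵐ[μ] (W m).indicator (fun _ => (1 : ℝ)))
    (hψ' : IsParsevalMultiwavelet μ p ϖ ε ψ) (m : Fin L) : TranslatesDisjoint p ϖ ε μ (W m) := by
  refine h.translatesDisjoint_of_tsum_le (hW m) (hψ m) ?_
  rw [LinearIsometryEquiv.enorm_map, ← hasSum_sq_norm_iff.1 (hψ'.2 (ψ m) trivial)]
  have h1 : ∀ k, inner ℂ (h.modulation (u p ϖ ε k) (h.fourierL2 (ψ m))) (h.fourierL2 (ψ m)) =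
      inner ℂ (affineSystem μ p ϖ ε ψ (m, (0, k))) (ψ m) := fun k => by
    rw [← h.inner_T, affineSystem, dilation_zero]
  simp_rw [h1]
  exact ENNReal.tsum_comp_le_tsum_of_injective (f := fun k : ℕ => (m, ((0 : ℤ), k)))
    (fun k l hkl => by simpa using hkl)
    fun i => ‖inner ℂ (affineSystem μ p ϖ ε ψ i) (ψ m)‖ₑ ^ 2

/-- The negative scales form a Parseval frame for the functions with spectrum in the stated set.
There the orbit of `ξ` already meets some `W m` at a negative index, so by uniqueness the scales `j
≥ 0` contribute nothing. -/
theorem negativeDilates_eq (hW : ∀ m, MeasurableSet (W m))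
    (hψ : ∀ m, (fun ξ => ‖h.fourierL2 (ψ m) ξ‖) =ᵐ[μ] (W m).indicator (fun _ => (1 : ℝ)))
    (hdisj : ∀ m, TranslatesDisjoint p ϖ ε μ (W m))
    (hC : ∀ᵐ ξ ∂μ, ∃! i : Fin L × ℤ, ϖ ^ i.2 • ξ ∈ W i.1) :
    negativeDilates μ p ϖ ε ψ = h.bandlimited {ξ | ∃ m, ∃ j : ℤ, j < 0 ∧ ϖ ^ j • ξ ∈ W m} := by
  set U : Set K := {ξ | ∃ m, ∃ j : ℤ, j < 0 ∧ ϖ ^ j • ξ ∈ W m} with hU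
  have hframe : IsParsevalFrameFor
      (fun i : {i : Fin L × ℤ × ℕ | i.2.1 < 0} => affineSystem μ p ϖ ε ψ i) (h.bandlimited U) := by
    constructor
    · rintro ⟨⟨m, j, k⟩, hj⟩
      have h1 : affineSystem μ p ϖ ε ψ (m, j, k) ∈
          (h.bandlimited (W m)).map (dilation μ (p ^ c) ϖ j) :=
        ⟨_, h.translation_mem_bandlimited _ (h.mem_bandlimited_of_norm_eq (hψ m)), rfl⟩
      rw [h.map_dilation_bandlimited] at h1
      refine h.bandlimited_mono (LE.le.eventuallyLE fun ξ hξ => ?_) h1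
      exact ⟨m, j, hj, mem_zpow_neg_smul_set.1 hξ⟩
    · intro f hf
      have h1 := hasSum_sq_norm_iff.1 (((h.isParsevalMultiwavelet_iff hW hψ hdisj).2 hC).2 f trivial)
      rw [hasSum_sq_norm_iff, ← h1]
      refine tsum_subtype_eq_of_support_subset
        (f := fun i => ‖inner ℂ (affineSystem μ p ϖ ε ψ i) f‖ₑ ^ 2) ?_
      rintro ⟨m, j, k⟩ hi
      by_contra hj
      refine hi ?_
      have h2 := h.tsum_enorm_inner_dilation_T (hW m) (hψ m) (hdisj m) j f
      have h3 : ∀ᵐ ξ ∂μ, (W m).indicator 1 (ϖ ^ j • ξ) * ‖h.fourierL2 f ξ‖ₑ ^ 2 = 0 := by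
        filter_upwards [hC, h.mem_bandlimited.1 hf] with ξ h4 h5
        by_cases hξ : ξ ∈ U
        · obtain ⟨m', j', hj', hmem⟩ := hξ
          rw [Set.indicator_of_notMem, zero_mul]
          intro H
          have := h4.unique (y₁ := (m, j)) (y₂ := (m', j')) H hmem
          rw [Prod.mk.injEq] at this
          exact hj (this.2 ▸ hj')
        · rw [h5 hξ]; simp
      rw [lintegral_congr_ae h3, lintegral_zero, ENNReal.tsum_eq_zero] at h2
      exact h2 k
  rw [← hframe.topologicalClosure_span (h.isClosed_bandlimited U), negativeDilates,
    Set.image_eq_range]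

/-- The points of `K` whose `ϖ⁻¹`-digit has the number `b`. -/
def digitClass (p : ℕ) {c : ℕ} (ϖ : Kˣ) (ε : Fin c → K) (b : ℕ) : Set K :=
  ⋃ n, Metric.closedBall (u p ϖ ε (b + p ^ c * n)) 1

theorem measurableSet_digitClass (b : ℕ) : MeasurableSet (digitClass p ϖ ε b) :=
  MeasurableSet.iUnion fun _ => measurableSet_closedBall' _ _

theorem existsUnique_mem_digitClass (x : K) :
    ∃! b : Fin (p ^ c), x ∈ digitClass p ϖ ε b := by
  obtain ⟨n, hn⟩ := h.exists_norm_sub_u_le x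
  obtain ⟨b, hb, m, rfl⟩ := h.exists_eq_add_mul n
  refine ⟨⟨b, hb⟩, Set.mem_iUnion.2 ⟨m, by rwa [mem_closedBall_iff_norm]⟩, ?_⟩
  rintro ⟨b', hb'⟩ hx
  obtain ⟨m', hm'⟩ := Set.mem_iUnion.1 hx
  rw [mem_closedBall_iff_norm] at hm'
  have h1 := congrArg (· % p ^ c) (h.eq_of_norm_sub_u_le hm' hn)
  simp only [Nat.add_mul_mod_self_left, Nat.mod_eq_of_lt hb, Nat.mod_eq_of_lt hb'] at h1
  exact Fin.ext h1

/-- If two points of one digit class differ by an element of the group of all `u(n)`, that element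
has lowest digit zero, so it is `ϖ⁻¹` times another group element. Multiplying by `ϖ` yields two
points of `S` differing by a group element. -/
theorem translatesDisjoint_inter_digitClass {S : Set K} (hdisj : TranslatesDisjoint p ϖ ε μ S)
    {b : ℕ} (hb : b < p ^ c) :
    TranslatesDisjoint p ϖ ε μ ((ϖ⁻¹ • S) ∩ digitClass p ϖ ε b) := by
  -- Relative to the base point `ϖx + ϖu(m) - u(m')`, the points `ϖ(x + u(m))` and `ϖ(x + u(n))` are
  -- translates by `u(m')` and `u(n')`. The base point depends on `m` and `m'`, so all countably
  -- many offsets are handled before fixing `x`.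
  have h1 : ∀ᵐ x ∂μ, ∀ k l, ∀ m n,
      ϖ • x + (ϖ • u p ϖ ε k - u p ϖ ε l) + u p ϖ ε m ∈ S →
      ϖ • x + (ϖ • u p ϖ ε k - u p ϖ ε l) + u p ϖ ε n ∈ S → m = n := by
    rw [ae_all_iff]; intro k
    rw [ae_all_iff]; intro l
    exact ae_comp_smul (P := fun x => ∀ m n,
      x + (ϖ • u p ϖ ε k - u p ϖ ε l) + u p ϖ ε m ∈ S →
      x + (ϖ • u p ϖ ε k - u p ϖ ε l) + u p ϖ ε n ∈ S → m = n)
      ((measurePreserving_add_right μ _).quasiMeasurePreserving.ae hdisj) ϖ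
  filter_upwards [h1] with x hx m n hm hn
  obtain ⟨hmS, hmb⟩ := hm
  obtain ⟨hnS, hnb⟩ := hn
  obtain ⟨m', hm'⟩ := Set.mem_iUnion.1 hmb
  obtain ⟨n', hn'⟩ := Set.mem_iUnion.1 hnb
  rw [mem_closedBall_iff_norm] at hm' hn'
  rw [Set.mem_inv_smul_set_iff] at hmS hnS
  have h2 : u p ϖ ε m - u p ϖ ε n =
      u p ϖ ε (b + p ^ c * m') - u p ϖ ε (b + p ^ c * n') := by
    obtain ⟨k, hk⟩ := h.exists_u_sub m n
    obtain ⟨l, hl⟩ := h.exists_u_sub (b + p ^ c * m') (b + p ^ c * n')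
    rw [hk, hl]
    congr 1
    apply h.eq_of_norm_u_sub_le
    rw [← hk, ← hl, show ∀ a b c d e : K, a - b - (c - d) = (e + a - c) + -(e + b - d) by
      intros; ring]
    · refine (IsUltrametricDist.norm_add_le_max _ _).trans (max_le hm' ?_)
      rwa [norm_neg]
  rw [h.u_add_mul hb, h.u_add_mul hb] at h2
  have h3 : (ϖ : K) * u p ϖ ε m - u p ϖ ε m' = ϖ * u p ϖ ε n - u p ϖ ε n' := by
    have : (ϖ : K) * (u p ϖ ε m - u p ϖ ε n) = u p ϖ ε m' - u p ϖ ε n' := by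
      rw [h2]
      field_simp
      ring
    linear_combination this
  have h4 := hx m m' m' n'
    (by convert hmS using 1; simp only [Units.smul_def, smul_eq_mul]; ring)
    (by
      convert hnS using 1
      simp only [Units.smul_def, smul_eq_mul]
      linear_combination h3)
  rw [h4, sub_left_inj] at h3
  exact h.u_injective (mul_left_cancel₀ ϖ.ne_zero h3)

theorem translatesDisjoint_mono {S T : Set K} (hST : S ⊆ T)
    (hT : TranslatesDisjoint p ϖ ε μ T) : TranslatesDisjoint p ϖ ε μ S :=
  hT.mono fun _ hx m n hm hn => hx m n (hST hm) (hST hn)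

theorem measure_inv_smul_lt_top {S : Set K} (hfin : μ S < ∞) : μ (ϖ⁻¹ • S) < ∞ := by
  rw [← distribHaarChar_mul μ ϖ⁻¹ S]
  exact ENNReal.mul_lt_top ENNReal.coe_lt_top hfin

theorem exists_norm_fourierL2_eq {S : Set K} (hS : MeasurableSet S) (hfin : μ S < ∞) :
    ∃ ψ : Lp ℂ 2 μ, (fun ξ => ‖h.fourierL2 ψ ξ‖) =ᵐ[μ] S.indicator (fun _ => (1 : ℝ)) := by
  refine ⟨h.fourierL2.symm (indicatorConstLp 2 hS hfin.ne 1), ?_⟩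
  rw [LinearIsometryEquiv.apply_symm_apply]
  have hae : indicatorConstLp 2 hS hfin.ne (1 : ℂ) =ᵐ[μ] _ := indicatorConstLp_coeFn
  refine hae.mono fun ξ hξ => ?_
  beta_reduce
  rw [hξ, norm_indicator_eq_indicator_norm]
  simp

/-- `ϖ⁻¹S \ S` need not have disjoint translates, but its intersections with the `q` digit classes
do; hence the order `q`. -/
theorem exists_isParsevalMultiwaveletSetOf {S : Set K} (hS : MeasurableSet S) (hfin : μ S < ∞)
    (hdisj : TranslatesDisjoint p ϖ ε μ S)
    (hcover : (⋃ j : ℤ, ϖ ^ (-j) • S) =ᵐ[μ] (Set.univ : Set K))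
    (hsub : S ≤ᵐ[μ] (ϖ⁻¹ • S : Set K)) :
    IsParsevalMultiwaveletSetOf μ p ϖ ε χ (h.bandlimited S) (p ^ c) ((ϖ⁻¹ • S) \ S) := by
  let W : Fin (p ^ c) → Set K := fun b => ((ϖ⁻¹ • S) \ S) ∩ digitClass p ϖ ε b
  have hW : ∀ b, MeasurableSet (W b) := fun b =>
    ((hS.const_smul _).diff hS).inter (h.measurableSet_digitClass b)
  have hWfin : ∀ b, μ (W b) < ∞ := fun b =>
    (measure_mono fun x hx => hx.1.1).trans_lt (h.measure_inv_smul_lt_top hfin)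
  have hWd : ∀ b, TranslatesDisjoint p ϖ ε μ (W b) := fun b =>
    h.translatesDisjoint_mono (Set.inter_subset_inter_left _ Set.sdiff_subset)
      (h.translatesDisjoint_inter_digitClass hdisj b.2)
  choose ψ hψ using fun b => h.exists_norm_fourierL2_eq (hW b) (hWfin b)
  have hthr := h.exists_threshold hS hfin hcover hsub
  -- An orbit that is in `S` exactly from `j₀` on meets `ϖ⁻¹S \ S` only at `j₀ - 1`. This gives both
  -- Calderón's condition and the identification of the negative dilates with `S`.
  have hmem : ∀ {x : K} {j₀ : ℤ}, (∀ j : ℤ, ϖ ^ j • x ∈ S ↔ j₀ ≤ j) → ∀ j : ℤ,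
      ϖ ^ j • x ∈ (ϖ⁻¹ • S) \ S ↔ j = j₀ - 1 := by
    intro x j₀ hj₀ j
    rw [Set.mem_sdiff, Set.mem_inv_smul_set_iff, smul_smul, ← zpow_one_add, hj₀, hj₀]
    omega
  have hC : ∀ᵐ ξ ∂μ, ∃! i : Fin (p ^ c) × ℤ, ϖ ^ i.2 • ξ ∈ W i.1 := by
    filter_upwards [hthr] with ξ hξ
    obtain ⟨j₀, hj₀⟩ := hξ
    obtain ⟨b, hb, huniq⟩ := h.existsUnique_mem_digitClass (ϖ ^ (j₀ - 1) • ξ)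
    refine ⟨(b, j₀ - 1), ⟨(hmem hj₀ _).2 rfl, hb⟩, ?_⟩
    rintro ⟨b', j⟩ ⟨h1, h2⟩
    obtain rfl := (hmem hj₀ _).1 h1
    rw [huniq b' h2]
  refine ⟨ψ, W, hW, ?_, fun b => (h.fourierModulusEq_iff _ _).2 (hψ b),
    (h.isParsevalMultiwavelet_iff hW hψ hWd).2 hC, ?_⟩
  · rw [← Set.inter_iUnion, Set.inter_eq_self_of_subset_left]
    exact fun x _ => Set.mem_iUnion.2 (h.existsUnique_mem_digitClass x).exists
  · rw [h.negativeDilates_eq hW hψ hWd hC]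
    have hUS : {ξ | ∃ b, ∃ j : ℤ, j < 0 ∧ ϖ ^ j • ξ ∈ W b} =ᵐ[μ] S := by
      rw [eventuallyEq_set]
      filter_upwards [hthr] with ξ hξ
      obtain ⟨j₀, hj₀⟩ := hξ
      have h0 : ξ ∈ S ↔ j₀ ≤ 0 := by simpa using hj₀ 0
      rw [h0]
      constructor
      · rintro ⟨b, j, hj, hjW, -⟩
        rw [hmem hj₀] at hjW
        omega
      · intro hle
        obtain ⟨b, hb, -⟩ := h.existsUnique_mem_digitClass (ϖ ^ (j₀ - 1) • ξ)
        exact ⟨b, j₀ - 1, by omega, (hmem hj₀ _).2 rfl, hb⟩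
    exact le_antisymm (h.bandlimited_mono hUS.le) (h.bandlimited_mono hUS.symm.le)

/-- Let `j₀` be the unique index at which the orbit of `ξ` meets `W`. Comparing spectra of the two
descriptions of the core space, `ξ ∈ S` means `j₀ < 0` and `ξ ∈ ϖ⁻¹S` means `j₀ < 1`. So the
difference set is `j₀ = 0`, that is, `ξ ∈ W`. -/
theorem ae_eq_of_isParsevalMultiwaveletSetOf {S : Set K} (hS : MeasurableSet S) {L : ℕ}
    {W : Set K} (hW : IsParsevalMultiwaveletSetOf μ p ϖ ε χ (h.bandlimited S) L W) :
    W =ᵐ[μ] ((ϖ⁻¹ • S) \ S : Set K) ∧ S =ᵐ[μ] (⋃ j : ℕ, ϖ ^ (j + 1) • W : Set K) := by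
  obtain ⟨ψ, Wm, hWm, rfl, hψ, hψ', hV⟩ := hW
  simp_rw [h.fourierModulusEq_iff] at hψ
  have hWd := h.translatesDisjoint_of_isParsevalMultiwavelet hWm hψ hψ'
  have hC := (h.isParsevalMultiwavelet_iff hWm hψ hWd).1 hψ'
  rw [h.negativeDilates_eq hWm hψ hWd hC] at hV
  set U : Set K := {ξ | ∃ m, ∃ j : ℤ, j < 0 ∧ ϖ ^ j • ξ ∈ Wm m} with hU
  have hUeq : U = ⋃ j : ℕ, ϖ ^ (j + 1) • ⋃ m, Wm m := by
    ext ξ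
    simp only [hU, Set.mem_ofPred_eq, Set.mem_iUnion, Set.mem_smul_set_iff_inv_smul_mem]
    constructor
    · rintro ⟨m, j, hj, hmem⟩
      obtain ⟨n, rfl⟩ := Int.exists_eq_neg_ofNat hj.le
      obtain ⟨n, rfl⟩ := Nat.exists_eq_succ_of_ne_zero (n := n) (by rintro rfl; simp at hj)
      refine ⟨n, m, ?_⟩
      rwa [zpow_neg, zpow_natCast] at hmem
    · rintro ⟨n, m, hmem⟩
      refine ⟨m, -((n + 1 : ℕ) : ℤ), by omega, ?_⟩
      rwa [zpow_neg, zpow_natCast]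
  have hUm : MeasurableSet U := by
    rw [hUeq]
    exact MeasurableSet.iUnion fun j => (MeasurableSet.iUnion hWm).const_smul _
  have hSU : S =ᵐ[μ] U :=
    (h.ae_le_of_bandlimited_le hS hV.ge).antisymm (h.ae_le_of_bandlimited_le hUm hV.le)
  refine ⟨?_, by rw [← hUeq]; exact hSU⟩
  rw [eventuallyEq_set] at hSU ⊢
  filter_upwards [hC, hSU, ae_comp_smul hSU ϖ] with ξ h1 h2 h3
  obtain ⟨⟨m₀, j₀⟩, hm₀, huniq⟩ := h1
  have hj : ∀ m j, ϖ ^ j • ξ ∈ Wm m → m = m₀ ∧ j = j₀ := fun m j hmem => by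
    simpa using huniq (m, j) hmem
  have h4 : ξ ∈ U ↔ j₀ < 0 := by
    constructor
    · rintro ⟨m, j, hlt, hmem⟩
      rwa [← (hj m j hmem).2]
    · exact fun hlt => ⟨m₀, j₀, hlt, hm₀⟩
  have h5 : ϖ • ξ ∈ U ↔ j₀ < 1 := by
    constructor
    · rintro ⟨m, j, hlt, hmem⟩
      rw [smul_smul, ← zpow_add_one] at hmem
      have := (hj m _ hmem).2
      omega
    · refine fun hlt => ⟨m₀, j₀ - 1, by omega, ?_⟩
      rwa [smul_smul, ← zpow_add_one, sub_add_cancel]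
  rw [Set.mem_sdiff, Set.mem_inv_smul_set_iff, h2, h3, h4, h5, Set.mem_iUnion]
  constructor
  · rintro ⟨m, hm⟩
    have := (hj m 0 (by simpa using hm)).2
    omega
  · intro hlt
    obtain rfl : j₀ = 0 := by omega
    exact ⟨m₀, by simpa using hm₀⟩

end IsHarmonicSetting

end Wavelets

end LocalFieldWavelet

/-! ### The characterization of scaling sets and of their multiwavelet sets. -/

open LocalFieldWavelet in
theorem proposition4p4 {K : Type*} [NontriviallyNormedField K] [IsUltrametricDist K]
    [LocallyCompactSpace K] [MeasurableSpace K] [BorelSpace K]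
    {p c : ℕ} (hp : p.Prime) [CharP K p]
    {ϖ : Kˣ} (hϖ : IsPrimeElement (ϖ : K))
    {ε : Fin c → K} (hε : IsResidueBasis p ε)
    {χ : AddChar K Circle} (hχ : IsNormalizedCharacter p ϖ ε χ)
    (μ : Measure K) [μ.IsAddHaarMeasure] (hμ : μ (Metric.closedBall (0 : K) 1) = 1)
    (φ : Lp ℂ 2 μ) (S : Set K) (hS : MeasurableSet S) (hφ : FourierModulusEq χ μ φ S) :
    ((∃ V : Submodule ℂ (Lp ℂ 2 μ), IsPMRA μ p ϖ ε V φ) ↔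
      Pairwise (fun k l : ℕ => AEDisjoint μ (u p ϖ ε k +ᵥ S) (u p ϖ ε l +ᵥ S)) ∧
      (⋃ j : ℤ, ϖ ^ (-j) • S) =ᵐ[μ] (Set.univ : Set K) ∧
      S ≤ᵐ[μ] (ϖ⁻¹ • S : Set K)) ∧
    (∀ V : Submodule ℂ (Lp ℂ 2 μ), IsPMRA μ p ϖ ε V φ →
      (∃ L : ℕ, IsParsevalMultiwaveletSetOf μ p ϖ ε χ V L ((ϖ⁻¹ • S) \ S)) ∧
      (∀ (L : ℕ) (W : Set K), IsParsevalMultiwaveletSetOf μ p ϖ ε χ V L W →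
        W =ᵐ[μ] ((ϖ⁻¹ • S) \ S : Set K) ∧
        S =ᵐ[μ] (⋃ j : ℕ, ϖ ^ (j + 1) • W : Set K))) := by
  have h : IsHarmonicSetting p ϖ ε χ μ := ⟨⟨hp, inferInstance, hϖ, hε⟩, hχ, hμ⟩
  rw [h.fourierModulusEq_iff] at hφ
  rw [← h.translatesDisjoint_iff]
  refine ⟨⟨?_, fun ⟨h1, h2, h3⟩ => ⟨_, h.isPMRA_bandlimited hS hφ h1 h2 h3⟩⟩, ?_⟩
  · rintro ⟨V, hV⟩
    obtain ⟨hd, rfl⟩ := h.bandlimited_of_isPMRA hS hφ hV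
    exact ⟨hd, h.iUnion_ae_eq_univ_of_isPMRA hV, h.ae_le_smul_of_isPMRA hS hV⟩
  · intro V hV
    obtain ⟨hd, rfl⟩ := h.bandlimited_of_isPMRA hS hφ hV
    exact ⟨⟨_, h.exists_isParsevalMultiwaveletSetOf hS (h.measure_lt_top hS hφ) hd
      (h.iUnion_ae_eq_univ_of_isPMRA hV) (h.ae_le_smul_of_isPMRA hS hV)⟩,
      fun L W hW => h.ae_eq_of_isParsevalMultiwaveletSetOf hS hW⟩
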